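/- For integers $m\ge 1$ let $$Q_m(x)=e^{-x}\sum_{j=0}^{m-1}\frac{x^j}{j!},\qquad f_m(x)=e^{-x}\frac{x^{m-1}}{(m-1)!}.$$ Let $(m_n)_{n\ge1}$ be an arbitrary sequence of integers with $m_n\ge 1$ (bounded or growing with $n$ at any speed). For all large $n$ let $b_n\ge0$ be the unique solution of $nQ_{m_n}(b_n)=1$ in $[0,\infty)$, and put $a_n=Q_{m_n}(b_n)/f_{m_n}(b_n)$. For each $n$ let $N_1,\dots,N_n$ be independent rate-one Poisson processes and let $$\tau_n=\inf\{t\ge 0: N_i(t)\ge m_n\text{ for every }1\le i\le n\}.$$ Let $T_{m_n}(n)$ be the number of independent draws, each uniform over $n$ coupon types, needed until every type has been drawn at least $m_n$ times. Let $G$ be a standard Gumbel variable, $\mathbb P(G\le x)=\exp(-e^{-x})$, and let $\gamma$ be Euler's constant. Then for every fixed real $r>0$, with all the moments finite, $$\mathbb E\left|\frac{\tau_n-b_n}{a_n}\right|^r\longrightarrow \mathbb E|G|^r\qquad(n\to\infty).$$ Moreover $T_{m_n}(n)$ has a finite second moment and, as $n\to\infty$, $$\mathbb E\,T_{m_n}(n)=nb_n+\gamma\,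 n a_n+o(n a_n),\qquad \operatorname{Var}\bigl(T_{m_n}(n)\bigr)=\frac{\pi^2}{6}\,n^2a_n^2+o(n^2a_n^2).$$ -/

import Mathlib

open MeasureTheory ProbabilityTheory Filter Topology
open scoped NNReal ENNReal

noncomputable section

/-- The survival function `Q_m(x) = e^{-x} ∑_{j < m} x^j / j!` of the Gamma (Erlang) law of
shape `m` and rate one. -/
def gammaTail (m : ℕ) (x : ℝ) : ℝ :=
  Real.exp (-x) * ∑ j ∈ Finset.range m, x ^ j / (j.factorial : ℝ)

/-- The density `f_m(x) = e^{-x} x^{m-1} / (m-1)!` of the same law (for `m ≥ 1`). -/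
def gammaDens (m : ℕ) (x : ℝ) : ℝ :=
  Real.exp (-x) * (x ^ (m - 1) / ((m - 1).factorial : ℝ))

/-- The standard Gumbel law on `ℝ`, with density `e^{-x - e^{-x}}`, that is, with distribution
function `e^{-e^{-x}}`. -/
def gumbelMeasure : Measure ℝ :=
  volume.withDensity fun x => ENNReal.ofReal (Real.exp (-x - Real.exp (-x)))

/-- `N` is a rate-one Poisson process under `P`: a counting process started at zero, with almost
surely nondecreasing right-continuous paths, independent increments, and `N t - N s` Poisson
distributed with mean `t - s` for `s ≤ t`. -/
structure IsUnitPoissonProcess {Ω : Type*} [MeasurableSpace Ω]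
    (N : ℝ≥0 → Ω → ℕ) (P : Measure Ω) : Prop where
  measurable : ∀ t, Measurable (N t)
  zero : ∀ᵐ ω ∂P, N 0 ω = 0
  mono : ∀ᵐ ω ∂P, Monotone fun t => N t ω
  rightCts : ∀ᵐ ω ∂P, ∀ t : ℝ≥0, ContinuousWithinAt (fun s => N s ω) (Set.Ici t) t
  indepIncrements : HasIndepIncrements N P
  law : ∀ s t : ℝ≥0, s ≤ t → P.map (fun ω => N t ω - N s ω) = poissonMeasure (t - s)

/-- `N i`, `i : Fin n`, are independent rate-one Poisson processes (independent as random
elements of the path space). -/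
structure AreIIDUnitPoisson {Ω : Type*} [MeasurableSpace Ω] {n : ℕ}
    (N : Fin n → ℝ≥0 → Ω → ℕ) (P : Measure Ω) : Prop where
  poisson : ∀ i, IsUnitPoissonProcess (N i) P
  indep : iIndepFun (fun (i : Fin n) (ω : Ω) (t : ℝ≥0) => N i t ω) P

/-- The Poissonized completion time `τ = inf {t ≥ 0 : N i t ≥ m for every i}`. -/
def poissonTime {Ω : Type*} {n : ℕ} (m : ℕ) (N : Fin n → ℝ≥0 → Ω → ℕ) (ω : Ω) : ℝ :=
  ((sInf {t : ℝ≥0 | ∀ i, m ≤ N i t ω} : ℝ≥0) : ℝ)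

/-- `U 0, U 1, …` are independent draws, each uniformly distributed over the `n` coupon types. -/
structure IsUniformDraws {Ω : Type*} [MeasurableSpace Ω] {n : ℕ}
    (U : ℕ → Ω → Fin n) (P : Measure Ω) : Prop where
  measurable : ∀ k, Measurable (U k)
  indep : iIndepFun U P
  uniform : ∀ k i, P {ω | U k ω = i} = (n : ℝ≥0∞)⁻¹

/-- The number of draws needed until each of the `n` coupon types has been drawn at least `m`
times: the least `k` such that every type occurs at least `m` times among the first `k` draws. -/
def couponTime {Ω : Type*} {n : ℕ} (m : ℕ) (U : ℕ → Ω → Fin n) (ω : Ω) : ℕ :=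
  sInf {k : ℕ | ∀ i : Fin n, m ≤ ((Finset.range k).filter fun j => U j ω = i).card}

end

/-! ### The Erlang survival function, its density, and the inverse hazard rate -/

/-! Write `m = k + 1`, `Q`, `f` for the Erlang tail and density, and `M = Q / f` for the inverse
hazard rate, so that `(log Q)' = -1/M` and `a_n = M(b_n)`. The time `τ_n` is the maximum of `n`
independent Erlang variables, with distribution function `(1 - Q)^n`. A Gumbel limit follows once `n
Q(b_n + a_n x) → e^{-x}`, which amounts to `M` being asymptotically constant on the window `b_n +
a_n x`.

Uniformity in `k` comes from explicit bounds. The recurrence `M_{k+2} = 1 + ((k+1)/x) M_{k+1}` shows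
that `M` is decreasing and lies between `x/(x-k) * (1 - k/(x-k)^2)` and `x/(x-k)` for `x > k`
(`millsRatio_le`, `le_millsRatio`). A median bound and these estimates keep `Q` bounded below on
`[0, k + C√(k+1)]`, whatever `k` is. As `Q(b_n) = 1/n → 0`, this forces `(b_n - k)/√(k+1) → ∞`, so
the two bounds merge and `M(b_n + a_n x) ~ M(b_n)` (`tendsto_millsRatio_mul_div`).

Moments converge by dominated convergence in the layer-cake formula. Both tails of `(τ_n - b_n)/a_n`
are at most `e^{-t}`: the upper one because the hazard rate increases, the lower one because `1 - Q`
is log-concave. The Gumbel mean and variance are read off from the generating function `Γ(1 - s)`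
and the reflection formula.

No coupling of the two problems is needed. Poissonization gives `P(τ > t) = ∑_k Poisson(nt){k} P(T >
k)`; integrating against `t^{r-1}` for `r = 1, 2` yields `E T = n E τ` and `E T(T+1) = n² E τ²`,
hence `Var T = n² Var τ - n E τ`. The correction `n E τ` is negligible against `n² a_n²` because
`b_n/(n a_n²) = O(log n / n)` (`tendsto_div_mul_millsRatio_sq`) and `a_n ≥ 1`. -/

lemma gammaDens_succ (k : ℕ) (x : ℝ) :
    gammaDens (k + 1) x = Real.exp (-x) * (x ^ k / (k.factorial : ℝ)) := rfl

lemma gammaTail_succ (m : ℕ) (x : ℝ) :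
    gammaTail (m + 1) x = gammaTail m x + gammaDens (m + 1) x := by
  simp [gammaTail, gammaDens_succ, Finset.sum_range_succ, mul_add]

lemma gammaTail_one (x : ℝ) : gammaTail 1 x = Real.exp (-x) := by simp [gammaTail]

lemma gammaDens_one (x : ℝ) : gammaDens 1 x = Real.exp (-x) := by simp [gammaDens]

lemma gammaDens_pos (k : ℕ) {x : ℝ} (hx : 0 < x) : 0 < gammaDens (k + 1) x := by
  rw [gammaDens_succ]; positivity

lemma gammaDens_nonneg (k : ℕ) {x : ℝ} (hx : 0 ≤ x) : 0 ≤ gammaDens (k + 1) x := by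
  rw [gammaDens_succ]; positivity

lemma gammaTail_pos (k : ℕ) {x : ℝ} (hx : 0 ≤ x) : 0 < gammaTail (k + 1) x := by
  induction k with
  | zero => rw [zero_add, gammaTail_one]; positivity
  | succ k ih => rw [gammaTail_succ]; linarith [gammaDens_nonneg (k + 1) hx]

lemma gammaTail_zero_right (k : ℕ) : gammaTail (k + 1) 0 = 1 := by
  induction k with
  | zero => simp [gammaTail_one]
  | succ k ih => rw [gammaTail_succ, ih, gammaDens_succ]; simp

lemma gammaDens_succ_succ (k : ℕ) (x : ℝ) :
    gammaDens (k + 2) x = x / (k + 1) * gammaDens (k + 1) x := by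
  rw [gammaDens_succ, gammaDens_succ, Nat.factorial_succ]
  push_cast
  have : (k.factorial : ℝ) ≠ 0 := by positivity
  field_simp
  ring

lemma hasDerivAt_gammaDens (k : ℕ) (x : ℝ) :
    HasDerivAt (gammaDens (k + 2)) (gammaDens (k + 1) x - gammaDens (k + 2) x) x := by
  have h1 : HasDerivAt (fun x : ℝ => Real.exp (-x)) (-Real.exp (-x)) x := by
    simpa using (hasDerivAt_neg x).exp
  have h2 := ((hasDerivAt_pow (k + 1) x).div_const ((k + 1).factorial : ℝ))
  refine ((h1.mul h2).congr_deriv ?_).congr_of_eventuallyEq (Eventually.of_forall fun y => ?_)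
  · rw [gammaDens_succ, gammaDens_succ, Nat.factorial_succ]
    push_cast
    have : (k.factorial : ℝ) ≠ 0 := by positivity
    field_simp
    ring
  · simp [gammaDens_succ]

lemma hasDerivAt_gammaTail (k : ℕ) (x : ℝ) :
    HasDerivAt (gammaTail (k + 1)) (-gammaDens (k + 1) x) x := by
  induction k with
  | zero =>
    have h1 : HasDerivAt (fun x : ℝ => Real.exp (-x)) (-Real.exp (-x)) x := by
      simpa using (hasDerivAt_neg x).exp
    rw [zero_add, gammaDens_one]
    exact h1.congr_of_eventuallyEq (Eventually.of_forall fun y => gammaTail_one y)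
  | succ k ih =>
    refine ((ih.add (hasDerivAt_gammaDens k x)).congr_deriv (by ring)).congr_of_eventuallyEq
      (Eventually.of_forall fun y => by simp [gammaTail_succ (k + 1)])

lemma continuous_gammaTail (k : ℕ) : Continuous (gammaTail (k + 1)) :=
  continuous_iff_continuousAt.2 fun x => (hasDerivAt_gammaTail k x).continuousAt

lemma gammaTail_lt_one (k : ℕ) {x : ℝ} (hx : 0 < x) : gammaTail (k + 1) x < 1 := by
  have h : StrictAntiOn (gammaTail (k + 1)) (Set.Ici 0) := by
    refine strictAntiOn_of_deriv_neg (convex_Ici 0) (continuous_gammaTail k).continuousOn ?_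
    intro y hy
    rw [interior_Ici] at hy
    rw [(hasDerivAt_gammaTail k y).deriv]
    linarith [gammaDens_pos k hy]
  simpa [gammaTail_zero_right] using h Set.self_mem_Ici hx.le hx

lemma gammaTail_le_one (k : ℕ) {x : ℝ} (hx : 0 ≤ x) : gammaTail (k + 1) x ≤ 1 := by
  rcases hx.eq_or_lt with rfl | h
  · rw [gammaTail_zero_right]
  · exact (gammaTail_lt_one k h).le

/-- A Chernoff bound for the Erlang tail. -/
lemma gammaTail_le_two_pow_mul_exp (m : ℕ) {x : ℝ} (hx : 0 ≤ x) :
    gammaTail m x ≤ 2 ^ m * Real.exp (-(x / 2)) := by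
  have h : ∑ j ∈ Finset.range m, x ^ j / (j.factorial : ℝ) ≤ 2 ^ m * Real.exp (x / 2) := by
    calc ∑ j ∈ Finset.range m, x ^ j / (j.factorial : ℝ)
        ≤ ∑ j ∈ Finset.range m, 2 ^ m * ((x / 2) ^ j / (j.factorial : ℝ)) := by
          refine Finset.sum_le_sum fun j hj => ?_
          have h2 : (2 : ℝ) ^ j ≤ 2 ^ m :=
            pow_le_pow_right₀ (by norm_num) (Finset.mem_range.1 hj).le
          have h3 : x ^ j / (j.factorial : ℝ) = 2 ^ j * ((x / 2) ^ j / (j.factorial : ℝ)) := by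
            rw [div_pow]; field_simp
          rw [h3]
          gcongr
      _ ≤ 2 ^ m * Real.exp (x / 2) := by
          rw [← Finset.mul_sum]
          gcongr
          exact Real.sum_le_exp_of_nonneg (by positivity) m
  calc gammaTail m x ≤ Real.exp (-x) * (2 ^ m * Real.exp (x / 2)) := by
        unfold gammaTail; gcongr
    _ = 2 ^ m * Real.exp (-(x / 2)) := by
        rw [mul_left_comm, ← Real.exp_add]; ring_nf

/-- The inverse hazard rate (Mills ratio) of the Erlang law. -/
noncomputable def millsRatio (m : ℕ) (x : ℝ) : ℝ := gammaTail m x / gammaDens m x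

lemma millsRatio_one (x : ℝ) : millsRatio 1 x = 1 := by
  rw [millsRatio, gammaTail_one, gammaDens_one, div_self (Real.exp_ne_zero _)]

lemma millsRatio_succ_succ (k : ℕ) {x : ℝ} (hx : 0 < x) :
    millsRatio (k + 2) x = 1 + (k + 1) / x * millsRatio (k + 1) x := by
  have h := (gammaDens_pos k hx).ne'
  rw [millsRatio, millsRatio, gammaTail_succ, gammaDens_succ_succ]
  field_simp
  ring

lemma millsRatio_pos (k : ℕ) {x : ℝ} (hx : 0 < x) : 0 < millsRatio (k + 1) x :=
  div_pos (gammaTail_pos k hx.le) (gammaDens_pos k hx)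

/-- By the recurrence: a product of two positive decreasing factors, plus one. Equivalently the
hazard rate increases and `Q` is log-concave, which is the source of the upper-tail bound. -/
lemma antitoneOn_millsRatio (k : ℕ) : AntitoneOn (millsRatio (k + 1)) (Set.Ioi 0) := by
  induction k with
  | zero => intro x _ y _ _; simp [millsRatio_one]
  | succ k ih =>
    intro x hx y hy hxy
    rw [millsRatio_succ_succ k hx, millsRatio_succ_succ k hy]
    have hx' : (0 : ℝ) < x := hx
    have := ih hx hy hxy
    have := millsRatio_pos k hy
    gcongr

/-- The value `x / (x - (k+1))` is the fixed point of `y ↦ 1 + ((k+1)/x) y`, the map that carries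
`M_{k+1}` to `M_{k+2}`. The induction therefore reproduces the bound. -/
lemma millsRatio_le (k : ℕ) {x : ℝ} (hx : (k : ℝ) < x) :
    millsRatio (k + 1) x ≤ x / (x - k) := by
  induction k with
  | zero => simp at hx; simp [millsRatio_one, hx.ne']
  | succ k ih =>
    push_cast at hx ⊢
    have hk : (0 : ℝ) ≤ k := k.cast_nonneg
    have hx0 : 0 < x := by linarith
    rw [millsRatio_succ_succ k hx0]
    have h1 := ih (by linarith)
    have h2 : x / (x - k) ≤ x / (x - (k + 1)) := by
      have : 0 < x - (k + 1) := by linarith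
      gcongr
      linarith
    calc 1 + (k + 1) / x * millsRatio (k + 1) x ≤ 1 + (k + 1) / x * (x / (x - (k + 1))) := by
          gcongr
          exact h1.trans h2
      _ = x / (x - (k + 1)) := by
          have : x - (k + 1) ≠ 0 := by linarith
          field_simp
          ring

/-- The relative error `k/(x-k)^2` is what must vanish for `M ~ x/(x-k)`; it does so exactly when
`x` is many multiples of `√k` beyond `k`. -/
lemma le_millsRatio (k : ℕ) {x : ℝ} (hx : (k : ℝ) < x) :
    x / (x - k) * (1 - k / (x - k) ^ 2) ≤ millsRatio (k + 1) x := by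
  induction k with
  | zero => simp at hx; simp [millsRatio_one, hx.ne']
  | succ k ih =>
    push_cast at hx ⊢
    have hk : (0 : ℝ) ≤ k := k.cast_nonneg
    have hx0 : 0 < x := by linarith
    rw [millsRatio_succ_succ k hx0]
    have h1 := ih (by linarith)
    obtain ⟨d, hd⟩ : ∃ d, d = x - (k + 1) := ⟨_, rfl⟩
    have hd0 : 0 < d := by linarith
    have hxd : x = d + 1 + k := by linarith
    refine le_trans ?_ (add_le_add_right (mul_le_mul_of_nonneg_left h1 (by positivity)) 1)
    have e1 : x - k = d + 1 := by linarith
    have e2 : x - (k + 1) = d := by linarith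
    rw [e1, e2, ← sub_nonneg]
    -- In terms of `d = x - (k+1)`, the slack in the induction step is a sum of visibly nonnegative
    -- terms.
    have e3 : 1 + (k + 1) / x * (x / (d + 1) * (1 - k / (d + 1) ^ 2))
        - x / d * (1 - (k + 1) / d ^ 2)
        = (k + 1) * (1 / (d ^ 2 * (d + 1)) + ((k + 1) / d ^ 3 - k / (d + 1) ^ 3)) := by
      have : x ≠ 0 := hx0.ne'
      field_simp
      rw [hxd]
      ring
    rw [e3]
    have h4 : (k : ℝ) / (d + 1) ^ 3 ≤ (k + 1) / d ^ 3 := by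
      gcongr <;> linarith
    have : 0 ≤ (k + 1) / d ^ 3 - (k : ℝ) / (d + 1) ^ 3 := by linarith
    positivity

lemma hasDerivAt_log_gammaTail (k : ℕ) {x : ℝ} (hx : 0 < x) :
    HasDerivAt (fun y => Real.log (gammaTail (k + 1) y)) (-(millsRatio (k + 1) x)⁻¹) x := by
  refine ((hasDerivAt_gammaTail k x).log (gammaTail_pos k hx.le).ne').congr_deriv ?_
  rw [millsRatio, inv_div, neg_div]

/-- Two-sided control of the decay of the Erlang tail by the inverse hazard rate. -/
lemma log_gammaTail_sub_mem (k : ℕ) {x y : ℝ} (hx : 0 < x) (hxy : x ≤ y) :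
    (y - x) / millsRatio (k + 1) x ≤
        Real.log (gammaTail (k + 1) x) - Real.log (gammaTail (k + 1) y) ∧
      Real.log (gammaTail (k + 1) x) - Real.log (gammaTail (k + 1) y) ≤
        (y - x) / millsRatio (k + 1) y := by
  rcases hxy.eq_or_lt with rfl | hlt
  · simp
  obtain ⟨c, hc, hc'⟩ := exists_hasDerivAt_eq_slope
    (fun y => Real.log (gammaTail (k + 1) y)) (fun y => -(millsRatio (k + 1) y)⁻¹) hlt
    (fun z hz => (hasDerivAt_log_gammaTail k (hx.trans_le hz.1)).continuousAt.continuousWithinAt)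
    (fun z hz => hasDerivAt_log_gammaTail k (hx.trans hz.1))
  have hc0 : 0 < c := hx.trans hc.1
  have hyx : 0 < y - x := by linarith
  have key : Real.log (gammaTail (k + 1) x) - Real.log (gammaTail (k + 1) y)
      = (y - x) / millsRatio (k + 1) c := by
    rw [eq_div_iff hyx.ne'] at hc'
    rw [div_eq_mul_inv]
    linarith
  have hM := millsRatio_pos k hc0
  have hMy := millsRatio_pos k (hx.trans hlt)
  rw [key]
  constructor
  · have := antitoneOn_millsRatio k hx hc0 hc.1.le
    gcongr
  · have := antitoneOn_millsRatio k hc0 (hx.trans hlt) hc.2.le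
    gcongr

/-! ### Log-concavity of the distribution function -/

/-- This is the sign condition for the derivative of `f / (1 - Q)`. Since `x f_{k+1} = (k+1)
f_{k+2}`, the difference of the two sides is smooth on the whole line; it vanishes at zero and has
derivative `f + (1 - Q) ≥ 0`. -/
lemma sub_mul_le_mul_gammaDens (k : ℕ) {x : ℝ} (hx : 0 ≤ x) :
    (k - x) * (1 - gammaTail (k + 1) x) ≤ x * gammaDens (k + 1) x := by
  have hd : ∀ y : ℝ, HasDerivAt (fun y => (k + 1) * gammaDens (k + 2) y
      - (k - y) * (1 - gammaTail (k + 1) y))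
      (gammaDens (k + 1) y + (1 - gammaTail (k + 1) y)) y := by
    intro y
    have h1 := (hasDerivAt_gammaDens k y).const_mul ((k : ℝ) + 1)
    have h2 := ((hasDerivAt_id y).const_sub (k : ℝ)).mul
      ((hasDerivAt_gammaTail k y).const_sub 1)
    refine (h1.sub h2).congr_deriv ?_
    have := gammaDens_succ_succ k y
    have hk : (k : ℝ) + 1 ≠ 0 := by positivity
    rw [this]
    simp only [id]
    field_simp
    ring
  have hm : MonotoneOn (fun y => (k + 1) * gammaDens (k + 2) y
      - (k - y) * (1 - gammaTail (k + 1) y)) (Set.Ici 0) := by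
    refine monotoneOn_of_deriv_nonneg (convex_Ici 0)
      (fun y _ => (hd y).continuousAt.continuousWithinAt)
      (fun y _ => (hd y).differentiableAt.differentiableWithinAt) fun y hy => ?_
    rw [interior_Ici] at hy
    have hy' : (0 : ℝ) < y := hy
    rw [(hd y).deriv]
    linarith [gammaDens_nonneg k hy'.le, gammaTail_le_one k hy'.le]
  have := hm Set.self_mem_Ici hx hx
  simp only [gammaTail_zero_right, gammaDens_succ_succ k] at this
  have hk : (k : ℝ) + 1 ≠ 0 := by positivity
  have e : ((k : ℝ) + 1) * (x / (k + 1) * gammaDens (k + 1) x) = x * gammaDens (k + 1) x := by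
    field_simp
  rw [e] at this
  simp at this
  linarith

lemma hasDerivAt_gammaDens_of_pos (k : ℕ) {x : ℝ} (hx : 0 < x) :
    HasDerivAt (gammaDens (k + 1)) ((k / x - 1) * gammaDens (k + 1) x) x := by
  rcases k with _ | k
  · have h1 : HasDerivAt (fun x : ℝ => Real.exp (-x)) (-Real.exp (-x)) x := by
      simpa using (hasDerivAt_neg x).exp
    simp only [zero_add, gammaDens_one]
    refine (h1.congr_deriv (by simp)).congr_of_eventuallyEq
      (Eventually.of_forall fun y => gammaDens_one y)
  · refine (hasDerivAt_gammaDens k x).congr_deriv ?_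
    rw [gammaDens_succ_succ]
    push_cast
    field_simp

lemma antitoneOn_gammaDens_div (k : ℕ) :
    AntitoneOn (fun x => gammaDens (k + 1) x / (1 - gammaTail (k + 1) x)) (Set.Ioi 0) := by
  have hd : ∀ x : ℝ, 0 < x → HasDerivAt
      (fun x => gammaDens (k + 1) x / (1 - gammaTail (k + 1) x))
      (((k / x - 1) * gammaDens (k + 1) x * (1 - gammaTail (k + 1) x) -
        gammaDens (k + 1) x * gammaDens (k + 1) x) / (1 - gammaTail (k + 1) x) ^ 2) x := by
    intro x hx
    have h0 : 1 - gammaTail (k + 1) x ≠ 0 := by linarith [gammaTail_lt_one k hx]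
    refine ((hasDerivAt_gammaDens_of_pos k hx).div ((hasDerivAt_gammaTail k x).const_sub 1) h0).congr_deriv
      (by simp)
  refine antitoneOn_of_deriv_nonpos (convex_Ioi 0)
      (fun y hy => (hd y hy).continuousAt.continuousWithinAt)
      (fun y hy => (hd y (by simpa using hy)).differentiableAt.differentiableWithinAt)
      fun x hx => ?_
  rw [interior_Ioi] at hx
  have hx' : (0 : ℝ) < x := hx
  rw [(hd x hx).deriv]
  refine div_nonpos_of_nonpos_of_nonneg ?_ (sq_nonneg _)
  have h1 := sub_mul_le_mul_gammaDens k hx'.le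
  have h2 : (k / x - 1) * (1 - gammaTail (k + 1) x) ≤ gammaDens (k + 1) x := by
    have : (k / x - 1) * (1 - gammaTail (k + 1) x)
        = (k - x) * (1 - gammaTail (k + 1) x) / x := by field_simp
    rw [this, div_le_iff₀ hx']
    linarith
  nlinarith [gammaDens_pos k hx']

/-- The tangent bound coming from log-concavity of the Erlang distribution function. -/
lemma le_log_one_sub_gammaTail_sub (k : ℕ) {x y : ℝ} (hx : 0 < x) (hxy : x ≤ y) :
    (y - x) * (gammaDens (k + 1) y / (1 - gammaTail (k + 1) y)) ≤
      Real.log (1 - gammaTail (k + 1) y) - Real.log (1 - gammaTail (k + 1) x) := by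
  rcases hxy.eq_or_lt with rfl | hlt
  · simp
  have hd : ∀ z : ℝ, 0 < z → HasDerivAt (fun y => Real.log (1 - gammaTail (k + 1) y))
      (gammaDens (k + 1) z / (1 - gammaTail (k + 1) z)) z := fun z hz =>
    (((hasDerivAt_gammaTail k z).const_sub 1).log
      (by linarith [gammaTail_lt_one k hz])).congr_deriv (by simp)
  obtain ⟨c, hc, hc'⟩ := exists_hasDerivAt_eq_slope
    (fun y => Real.log (1 - gammaTail (k + 1) y))
    (fun y => gammaDens (k + 1) y / (1 - gammaTail (k + 1) y)) hlt
    (fun z hz => (hd z (hx.trans_le hz.1)).continuousAt.continuousWithinAt)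
    (fun z hz => hd z (hx.trans hz.1))
  have hyx : 0 < y - x := by linarith
  rw [eq_div_iff hyx.ne'] at hc'
  have := antitoneOn_gammaDens_div k (hx.trans hc.1) (hx.trans hlt) hc.2.le
  simp only at this hc'
  nlinarith

/-! ### The median bound -/

/-- The density is skewed to the right about its mode `k`. With `s = t/k` the claim reduces to
`log((1+s)/(1-s)) ≥ 2s`, the first term of a power series with nonnegative terms. -/
lemma gammaDens_sub_le_gammaDens_add (k : ℕ) {t : ℝ} (h0 : 0 ≤ t) (h1 : t < k) :
    gammaDens (k + 1) (k - t) ≤ gammaDens (k + 1) (k + t) := by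
  have hk : (0 : ℝ) < k := h0.trans_lt h1
  have hk' : k ≠ 0 := by rintro rfl; simp at hk
  have hs : |t / k| < 1 := by
    rw [abs_of_nonneg (by positivity), div_lt_one hk]; exact h1
  have hlog : 2 * (t / k) ≤ Real.log (1 + t / k) - Real.log (1 - t / k) := by
    have := le_hasSum (Real.hasSum_log_sub_log_of_abs_lt_one hs) 0
      (fun j _ => by positivity)
    simpa using this
  have hlt : 0 < 1 - t / k := by linarith [(abs_lt.1 hs).2]
  have hpos : 0 < 1 + t / k := by positivity
  have hexp : Real.exp (2 * (t / k)) * (1 - t / k) ≤ 1 + t / k := by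
    rw [← Real.log_div hpos.ne' hlt.ne', Real.le_log_iff_exp_le (by positivity),
      le_div_iff₀ hlt] at hlog
    exact hlog
  have h2 : Real.exp (2 * t) * (k - t) ^ k ≤ (k + t) ^ k := by
    have h3 : Real.exp (2 * t) * (k - t) ^ k
        = (k * (Real.exp (2 * (t / k)) * (1 - t / k))) ^ k := by
      rw [mul_pow, mul_pow, ← Real.exp_nat_mul, mul_left_comm, ← mul_pow]
      congr 2 <;> field_simp
    rw [h3]
    calc _ ≤ ((k : ℝ) * (1 + t / k)) ^ k := by gcongr
      _ = _ := by congr 1; field_simp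
  rw [gammaDens_succ, gammaDens_succ, ← mul_div_assoc, ← mul_div_assoc]
  gcongr ?_ / _
  calc Real.exp (-(k - t)) * (k - t) ^ k
      = Real.exp (-(k + t)) * (Real.exp (2 * t) * (k - t) ^ k) := by
        rw [← mul_assoc, ← Real.exp_add]; ring_nf
    _ ≤ Real.exp (-(k + t)) * (k + t) ^ k := by gcongr

/-- The Erlang law of shape `k + 1` puts mass at least one half beyond `k`. -/
lemma half_le_gammaTail (k : ℕ) : 1 / 2 ≤ gammaTail (k + 1) k := by
  have hk : (0 : ℝ) ≤ k := k.cast_nonneg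
  have hd : ∀ t : ℝ, HasDerivAt (fun t => gammaTail (k + 1) (k + t) + gammaTail (k + 1) (k - t))
      (-gammaDens (k + 1) (k + t) + gammaDens (k + 1) (k - t)) t := by
    intro t
    have h1 := (hasDerivAt_gammaTail k (k + t)).comp t ((hasDerivAt_id t).const_add (k : ℝ))
    have h2 := (hasDerivAt_gammaTail k (k - t)).comp t ((hasDerivAt_id t).const_sub (k : ℝ))
    exact (h1.add h2).congr_deriv (by ring)
  have hm : AntitoneOn (fun t => gammaTail (k + 1) (k + t) + gammaTail (k + 1) (k - t))
      (Set.Icc 0 (k : ℝ)) := by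
    refine antitoneOn_of_deriv_nonpos (convex_Icc _ _)
      (fun y _ => (hd y).continuousAt.continuousWithinAt)
      (fun y _ => (hd y).differentiableAt.differentiableWithinAt) fun t ht => ?_
    rw [interior_Icc] at ht
    rw [(hd t).deriv]
    linarith [gammaDens_sub_le_gammaDens_add k ht.1.le ht.2]
  -- At `t = 0` the symmetrized tail is `2 Q(k)`; at `t = k` it is `Q(2k) + Q(0) ≥ 1`.
  have := hm (Set.left_mem_Icc.2 hk) (Set.right_mem_Icc.2 hk) hk
  simp only [sub_self, add_zero, sub_zero, gammaTail_zero_right] at this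
  linarith [gammaTail_pos k (add_nonneg hk hk)]

/-! ### Tail bounds for the centred and scaled Erlang law -/

lemma antitoneOn_gammaTail (k : ℕ) : AntitoneOn (gammaTail (k + 1)) (Set.Ici 0) := by
  refine antitoneOn_of_deriv_nonpos (convex_Ici 0) (continuous_gammaTail k).continuousOn
    (fun y _ => (hasDerivAt_gammaTail k y).differentiableAt.differentiableWithinAt) ?_
  intro y hy
  rw [interior_Ici] at hy
  rw [(hasDerivAt_gammaTail k y).deriv]
  linarith [gammaDens_pos k hy]

/-- Beyond `b` the hazard rate is at least `1/M(b)`, so `Q` loses at least a factor `e^{-x}` over a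
distance `M(b) x`. -/
lemma mul_gammaTail_add_le_exp (k : ℕ) {n b x : ℝ} (hb : 0 < b)
    (h : n * gammaTail (k + 1) b = 1) (hx : 0 ≤ x) :
    n * gammaTail (k + 1) (b + millsRatio (k + 1) b * x) ≤ Real.exp (-x) := by
  have hM := millsRatio_pos k hb
  have hle : b ≤ b + millsRatio (k + 1) b * x := by nlinarith
  have h1 := (log_gammaTail_sub_mem k hb hle).1
  have hQ := gammaTail_pos k hb.le
  have hQ' := gammaTail_pos k (hb.le.trans hle)
  have h2 : (b + millsRatio (k + 1) b * x - b) / millsRatio (k + 1) b = x := by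
    field_simp; ring
  rw [h2, ← Real.log_div hQ.ne' hQ'.ne', Real.le_log_iff_exp_le (by positivity),
    le_div_iff₀ hQ'] at h1
  have hn : n = (gammaTail (k + 1) b)⁻¹ := eq_inv_of_mul_eq_one_left h
  rw [hn, inv_mul_le_iff₀ hQ, Real.exp_neg, ← div_eq_mul_inv,
    le_div_iff₀ (Real.exp_pos x), mul_comm]
  exact h1

/-- The tangent to the concave function `log (1 - Q)` at `b` has slope `f/(1-Q) ≥ f`. Over the
distance `M x = (Q/f) x` it falls by at least `Q x`, while `log (1 - Q(b)) ≤ -Q(b)`. Multiplying by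
`n = 1/Q(b)` gives the exponent `-1 - x`. -/
lemma one_sub_gammaTail_pow_le_exp (k : ℕ) {n : ℕ} {b x : ℝ} (hb : 0 < b)
    (h : n * gammaTail (k + 1) b = 1) (hx : 0 ≤ x)
    (hy : 0 < b - millsRatio (k + 1) b * x) :
    (1 - gammaTail (k + 1) (b - millsRatio (k + 1) b * x)) ^ n ≤ Real.exp (-1 - x) := by
  have hM := millsRatio_pos k hb
  have hle : b - millsRatio (k + 1) b * x ≤ b := by nlinarith
  have h1 := le_log_one_sub_gammaTail_sub k hy hle
  have hQ := gammaTail_pos k hb.le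
  have hF : 0 < 1 - gammaTail (k + 1) b := by linarith [gammaTail_lt_one k hb]
  have hF' : 0 < 1 - gammaTail (k + 1) (b - millsRatio (k + 1) b * x) := by
    linarith [gammaTail_lt_one k hy]
  have hn : (0 : ℝ) < n := by
    rcases Nat.eq_zero_or_pos n with rfl | h0
    · simp at h
    · exact_mod_cast h0
  have h2 : (b - (b - millsRatio (k + 1) b * x)) *
      (gammaDens (k + 1) b / (1 - gammaTail (k + 1) b))
      = gammaTail (k + 1) b * x / (1 - gammaTail (k + 1) b) := by
    have := (gammaDens_pos k hb).ne'
    rw [millsRatio]; field_simp; ring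
  rw [h2] at h1
  have h3 : Real.log (1 - gammaTail (k + 1) b) ≤ - gammaTail (k + 1) b := by
    have := Real.log_le_sub_one_of_pos hF
    linarith
  have h4 : gammaTail (k + 1) b * x ≤ gammaTail (k + 1) b * x / (1 - gammaTail (k + 1) b) := by
    rw [le_div_iff₀ hF]
    have : 0 ≤ gammaTail (k + 1) b * x := by positivity
    nlinarith
  rw [← Real.log_le_iff_le_exp (by positivity), Real.log_pow]
  have h5 : Real.log (1 - gammaTail (k + 1) (b - millsRatio (k + 1) b * x))
      ≤ - gammaTail (k + 1) b * (1 + x) := by linarith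
  calc _ ≤ n * (- gammaTail (k + 1) b * (1 + x)) := by gcongr
    _ = - (n * gammaTail (k + 1) b) * (1 + x) := by ring
    _ = -1 - x := by rw [h]; ring

/-- Starting from `Q(k) ≥ 1/2`, the hazard rate up to `k + d`, with `d = C√(k+1)`, is at most
`1/M(k+d)`, which is of order `d/(k+d)`. The total loss in `log Q` is of order `d²/(k+d) ≤ C²`,
uniformly in `k`. -/
lemma half_mul_exp_le_gammaTail (k : ℕ) {C b : ℝ} (hC : 2 ≤ C) (hb : 0 ≤ b)
    (hbC : b ≤ k + C * √(k + 1)) :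
    1 / 2 * Real.exp (-(2 * C ^ 2)) ≤ gammaTail (k + 1) b := by
  have hk : (0 : ℝ) ≤ k := k.cast_nonneg
  have hs1 : 1 ≤ √((k : ℝ) + 1) := Real.one_le_sqrt.2 (by linarith)
  have hss : √((k : ℝ) + 1) ^ 2 = k + 1 := Real.sq_sqrt (by linarith)
  obtain ⟨d, hd⟩ : ∃ d, d = C * √((k : ℝ) + 1) := ⟨_, rfl⟩
  have hd2 : 2 ≤ d := by rw [hd]; nlinarith
  have hdd : d ^ 2 = C ^ 2 * (k + 1) := by rw [hd, mul_pow, hss]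
  rw [← hd] at hbC
  refine le_trans ?_ (antitoneOn_gammaTail k hb (show (0 : ℝ) ≤ k + d by positivity) hbC)
  -- The logarithmic estimate needs a positive left endpoint, so the exponential case `k = 0` is
  -- separate.
  rcases Nat.eq_zero_or_pos k with rfl | hkpos
  · rw [zero_add, gammaTail_one, Nat.cast_zero, zero_add]
    rw [Nat.cast_zero, zero_add, mul_one] at hdd
    have : Real.exp (-(2 * C ^ 2)) ≤ Real.exp (-d) := by
      apply Real.exp_le_exp.2
      nlinarith
    linarith [Real.exp_pos (-(2 * C ^ 2))]
  have hk0 : (0 : ℝ) < k := by exact_mod_cast hkpos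
  have hlog := (log_gammaTail_sub_mem k hk0 (show (k : ℝ) ≤ k + d by linarith)).2
  have hM := le_millsRatio k (show (k : ℝ) < k + d by linarith)
  rw [add_sub_cancel_left] at hlog hM
  -- Here `C ≥ 2` is used: the lower bound for `M(k+d)` keeps at least three quarters of its main
  -- term.
  have h1 : (k : ℝ) / d ^ 2 ≤ 1 / 4 := by
    have hC2 : 4 ≤ C ^ 2 := by nlinarith
    rw [hdd, div_le_iff₀ (by positivity)]
    nlinarith
  have h2 : (k + d) / d * (3 / 4) ≤ millsRatio (k + 1) (k + d) :=
    le_trans (by gcongr; linarith) hM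
  have h3 : d / millsRatio (k + 1) (k + d) ≤ 2 * C ^ 2 := by
    calc d / millsRatio (k + 1) (k + d) ≤ d / ((k + d) / d * (3 / 4)) := by gcongr
      _ = d ^ 2 / (k + d) * (4 / 3) := by field_simp
      _ ≤ C ^ 2 * (4 / 3) := by
        gcongr
        rw [hdd, div_le_iff₀ (by positivity)]
        gcongr
        linarith
      _ ≤ 2 * C ^ 2 := by nlinarith [sq_nonneg C]
  have hQ := gammaTail_pos k hk
  have hQ' := gammaTail_pos k (show 0 ≤ (k : ℝ) + d by positivity)
  have h4 : Real.log (1 / 2) ≤ Real.log (gammaTail (k + 1) k) :=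
    Real.log_le_log (by norm_num) (half_le_gammaTail k)
  rw [← Real.log_le_log_iff (by positivity) hQ', Real.log_mul (by norm_num) (Real.exp_ne_zero _),
    Real.log_exp]
  linarith

/-! ### Asymptotics of the centring and scaling -/

section Asymptotics

variable {k : ℕ+ → ℕ} {b : ℕ+ → ℝ}

lemma tendsto_pnat_coe_atTop : Tendsto (fun n : ℕ+ => ((n : ℕ) : ℝ)) atTop atTop :=
  tendsto_natCast_atTop_atTop.comp tendsto_PNat_val_atTop_atTop

lemma tendsto_sub_div_sqrt_atTop
    (hb : ∀ᶠ n : ℕ+ in atTop, 0 ≤ b n ∧ (n : ℝ) * gammaTail (k n + 1) (b n) = 1) :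
    Tendsto (fun n => (b n - k n) / √(k n + 1)) atTop atTop := by
  refine tendsto_atTop.2 fun C => ?_
  have h := tendsto_pnat_coe_atTop.eventually_gt_atTop (2 * Real.exp (2 * (max C 2) ^ 2))
  filter_upwards [hb, h] with n hn hlarge
  have hpos : 0 < √((k n : ℝ) + 1) := Real.sqrt_pos.2 (by positivity)
  by_contra! hlt
  rw [div_lt_iff₀ hpos] at hlt
  have hle : b n ≤ k n + max C 2 * √(k n + 1) := by
    have : C * √((k n : ℝ) + 1) ≤ max C 2 * √(k n + 1) := by gcongr; exact le_max_left _ _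
    linarith
  -- If `b n` were within `C` standard units of `k n`, the tail at `b n` would be bounded below,
  -- contradicting `Q(b n) = 1/n` for large `n`.
  have h1 := half_mul_exp_le_gammaTail (k n) (le_max_right C 2) hn.1 hle
  have h2 : (n : ℝ) * (1 / 2 * Real.exp (-(2 * (max C 2) ^ 2))) ≤ 1 := by
    exact (mul_le_mul_of_nonneg_left h1 (Nat.cast_nonneg _)).trans hn.2.le
  rw [Real.exp_neg] at h2
  have h3 := Real.exp_pos (2 * (max C 2) ^ 2)
  rw [show (n : ℝ) * (1 / 2 * (Real.exp (2 * (max C 2) ^ 2))⁻¹)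
    = n / (2 * Real.exp (2 * (max C 2) ^ 2)) by field_simp, div_le_one (by positivity)] at h2
  linarith

lemma eventually_lt_of_tail
    (hb : ∀ᶠ n : ℕ+ in atTop, 0 ≤ b n ∧ (n : ℝ) * gammaTail (k n + 1) (b n) = 1) :
    ∀ᶠ n in atTop, (k n : ℝ) < b n := by
  filter_upwards [(tendsto_sub_div_sqrt_atTop hb).eventually_gt_atTop 0] with n hn
  have hpos : 0 < √((k n : ℝ) + 1) := Real.sqrt_pos.2 (by positivity)
  have := (div_pos_iff_of_pos_right hpos).1 hn
  linarith

lemma tendsto_one_div_sub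
    (hb : ∀ᶠ n : ℕ+ in atTop, 0 ≤ b n ∧ (n : ℝ) * gammaTail (k n + 1) (b n) = 1) :
    Tendsto (fun n => 1 / (b n - k n)) atTop (𝓝 0) := by
  refine squeeze_zero' ?_ ?_ (tendsto_sub_div_sqrt_atTop hb).inv_tendsto_atTop
  · filter_upwards [eventually_lt_of_tail hb] with n hn
    have : 0 < b n - k n := by linarith
    positivity
  · filter_upwards [eventually_lt_of_tail hb] with n hn
    have : 0 < b n - k n := by linarith
    have hs1 : 1 ≤ √((k n : ℝ) + 1) := Real.one_le_sqrt.2 (by simp)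
    simp only [Pi.inv_apply, inv_div]
    gcongr

lemma tendsto_div_sub_sq
    (hb : ∀ᶠ n : ℕ+ in atTop, 0 ≤ b n ∧ (n : ℝ) * gammaTail (k n + 1) (b n) = 1) :
    Tendsto (fun n => k n / (b n - k n) ^ 2) atTop (𝓝 0) := by
  have h := (tendsto_sub_div_sqrt_atTop hb).inv_tendsto_atTop
  have h2 := h.mul h
  rw [mul_zero] at h2
  refine squeeze_zero (fun n => by positivity) (fun n => ?_) h2
  have hss : √((k n : ℝ) + 1) * √((k n : ℝ) + 1) = k n + 1 :=
    Real.mul_self_sqrt (by positivity)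
  have e : ((b n - k n) / √((k n : ℝ) + 1))⁻¹ * ((b n - k n) / √((k n : ℝ) + 1))⁻¹
      = (k n + 1) / (b n - k n) ^ 2 := by
    rw [← mul_inv, div_mul_div_comm, hss, inv_div, pow_two]
  refine le_trans ?_ e.ge
  gcongr
  linarith

/-- The inverse hazard rate is asymptotically constant on the scale it sets itself. -/
lemma tendsto_millsRatio_mul_div
    (hb : ∀ᶠ n : ℕ+ in atTop, 0 ≤ b n ∧ (n : ℝ) * gammaTail (k n + 1) (b n) = 1) (x : ℝ) :
    (∀ᶠ n in atTop, 0 < b n + millsRatio (k n + 1) (b n) * x) ∧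
    Tendsto (fun n => millsRatio (k n + 1) (b n + millsRatio (k n + 1) (b n) * x) *
      ((b n - k n) / b n)) atTop (𝓝 1) := by
  have hD := tendsto_one_div_sub hb
  have hw := tendsto_div_sub_sq hb
  have hlt := eventually_lt_of_tail hb
  have hM : ∀ᶠ n in atTop, 0 < millsRatio (k n + 1) (b n) ∧
      millsRatio (k n + 1) (b n) ≤ b n / (b n - k n) := by
    filter_upwards [hlt] with n hn
    exact ⟨millsRatio_pos _ ((k n).cast_nonneg.trans_lt hn), millsRatio_le _ hn⟩
  -- The bound is `M/(b-k) ≤ b/(b-k)^2 = 1/(b-k) + k/(b-k)^2`. So a shift by `M x` is negligible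
  -- relative to `b - k`, and a fortiori relative to `b`.
  have hu : Tendsto (fun n => millsRatio (k n + 1) (b n) / (b n - k n)) atTop (𝓝 0) := by
    have := hD.add hw
    rw [add_zero] at this
    refine squeeze_zero' ?_ ?_ this
    · filter_upwards [hlt, hM] with n hn hn'
      exact div_nonneg hn'.1.le (by linarith)
    · filter_upwards [hlt, hM] with n hn hn'
      have h0 : 0 < b n - k n := by linarith
      calc _ ≤ b n / (b n - k n) / (b n - k n) := by gcongr; exact hn'.2
        _ = _ := by field_simp; ring
  have hv : Tendsto (fun n => millsRatio (k n + 1) (b n) / b n) atTop (𝓝 0) := by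
    refine squeeze_zero' ?_ ?_ hD
    · filter_upwards [hlt, hM] with n hn hn'
      exact div_nonneg hn'.1.le ((k n).cast_nonneg.trans hn.le)
    · filter_upwards [hlt, hM] with n hn hn'
      have h0 : 0 < b n - k n := by linarith
      have hb0 : 0 < b n := (k n).cast_nonneg.trans_lt hn
      calc _ ≤ b n / (b n - k n) / b n := by gcongr; exact hn'.2
        _ = _ := by field_simp
  have hu1 : Tendsto (fun n => 1 + millsRatio (k n + 1) (b n) / (b n - k n) * x) atTop (𝓝 1) := by
    simpa using (hu.mul_const x).const_add 1
  have hv1 : Tendsto (fun n => 1 + millsRatio (k n + 1) (b n) / b n * x) atTop (𝓝 1) := by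
    simpa using (hv.mul_const x).const_add 1
  have hratio : Tendsto (fun n => (1 + millsRatio (k n + 1) (b n) / b n * x) /
      (1 + millsRatio (k n + 1) (b n) / (b n - k n) * x)) atTop (𝓝 1) :=
    (hv1.div hu1 one_ne_zero).mono_right (by rw [div_one])
  have hwu := hw.div (hu1.pow 2) (by norm_num)
  have hlow := hratio.mul (hwu.const_sub 1)
  simp only [Pi.div_apply, one_pow, div_one, sub_zero, mul_one] at hlow
  have hpos1 := hu1.eventually_const_lt one_pos
  have hpos2 := hv1.eventually_const_lt one_pos
  have hEq : ∀ᶠ n in atTop, 0 < b n ∧ 0 < b n - k n ∧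
      0 < b n + millsRatio (k n + 1) (b n) * x ∧
      (k n : ℝ) < b n + millsRatio (k n + 1) (b n) * x ∧
      b n + millsRatio (k n + 1) (b n) * x = b n * (1 + millsRatio (k n + 1) (b n) / b n * x) ∧
      b n + millsRatio (k n + 1) (b n) * x - k n
        = (b n - k n) * (1 + millsRatio (k n + 1) (b n) / (b n - k n) * x) := by
    filter_upwards [hlt, hpos1, hpos2] with n hn h1 h2
    have h0 : 0 < b n - k n := by linarith
    have hb0 : 0 < b n := (k n).cast_nonneg.trans_lt hn
    have e1 : b n + millsRatio (k n + 1) (b n) * x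
      = b n * (1 + millsRatio (k n + 1) (b n) / b n * x) := by field_simp
    have e2 : b n + millsRatio (k n + 1) (b n) * x - k n
        = (b n - k n) * (1 + millsRatio (k n + 1) (b n) / (b n - k n) * x) := by
      field_simp; ring
    refine ⟨hb0, h0, by rw [e1]; positivity, ?_, e1, e2⟩
    have : 0 < b n + millsRatio (k n + 1) (b n) * x - k n := by rw [e2]; positivity
    linarith
  refine ⟨hEq.mono fun n hn => hn.2.2.1, ?_⟩
  refine tendsto_of_tendsto_of_tendsto_of_le_of_le' hlow hratio ?_ ?_
  · filter_upwards [hEq, hpos1, hpos2] with n ⟨hb0, h0, h3, h4, e1, e2⟩ h1 h2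
    have h5 := le_millsRatio (k n) h4
    have h6 : 0 ≤ (b n - k n) / b n := by positivity
    refine le_trans (le_of_eq ?_) (mul_le_mul_of_nonneg_right h5 h6)
    rw [e2, e1]
    field_simp
  · filter_upwards [hEq, hpos1, hpos2] with n ⟨hb0, h0, h3, h4, e1, e2⟩ h1 h2
    have h5 := millsRatio_le (k n) h4
    have h6 : 0 ≤ (b n - k n) / b n := by positivity
    refine le_trans (mul_le_mul_of_nonneg_right h5 h6) (le_of_eq ?_)
    rw [e2, e1]
    field_simp

/-- The expected number of coordinates exceeding `b + a x` converges to `e^{-x}`. -/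
lemma tendsto_mul_gammaTail
    (hb : ∀ᶠ n : ℕ+ in atTop, 0 ≤ b n ∧ (n : ℝ) * gammaTail (k n + 1) (b n) = 1) (x : ℝ) :
    Tendsto (fun n : ℕ+ => (n : ℝ) *
      gammaTail (k n + 1) (b n + millsRatio (k n + 1) (b n) * x)) atTop (𝓝 (Real.exp (-x))) := by
  obtain ⟨hpos, hx⟩ := tendsto_millsRatio_mul_div hb x
  have h0 := (tendsto_millsRatio_mul_div hb 0).2
  simp only [mul_zero, add_zero] at h0
  -- Dividing the cases `0` and `x` cancels the common factor `(b-k)/b` and leaves `M(b)/M(b + M(b)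
  -- x) → 1`.
  have hr := (h0.div hx one_ne_zero).const_mul x
  simp only [Pi.div_apply, div_one, mul_one] at hr
  have hlt := eventually_lt_of_tail hb
  have hL : Tendsto (fun n => Real.log (gammaTail (k n + 1) (b n)) -
      Real.log (gammaTail (k n + 1) (b n + millsRatio (k n + 1) (b n) * x))) atTop (𝓝 x) := by
    have hr' : Tendsto (fun n => x * (millsRatio (k n + 1) (b n) /
        millsRatio (k n + 1) (b n + millsRatio (k n + 1) (b n) * x))) atTop (𝓝 x) := by
      refine hr.congr' ?_
      filter_upwards [hlt] with n hn
      have h0 : b n - k n ≠ 0 := by linarith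
      have hb0 : b n ≠ 0 := ((k n).cast_nonneg.trans_lt hn).ne'
      rw [mul_div_mul_right _ _ (div_ne_zero h0 hb0)]
    rcases le_total 0 x with hx0 | hx0
    · refine tendsto_of_tendsto_of_tendsto_of_le_of_le' tendsto_const_nhds hr' ?_ ?_
      · filter_upwards [hlt] with n hn
        have hb0 := (k n).cast_nonneg.trans_lt hn
        have hM := millsRatio_pos (k n) hb0
        have := (log_gammaTail_sub_mem (k n) hb0
          (show b n ≤ b n + millsRatio (k n + 1) (b n) * x by nlinarith)).1
        rwa [add_sub_cancel_left, mul_div_cancel_left₀ _ hM.ne'] at this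
      · filter_upwards [hlt] with n hn
        have hb0 := (k n).cast_nonneg.trans_lt hn
        have hM := millsRatio_pos (k n) hb0
        have := (log_gammaTail_sub_mem (k n) hb0
          (show b n ≤ b n + millsRatio (k n + 1) (b n) * x by nlinarith)).2
        rw [add_sub_cancel_left] at this
        refine this.trans (le_of_eq (by ring))
    · refine tendsto_of_tendsto_of_tendsto_of_le_of_le' tendsto_const_nhds hr' ?_ ?_
      · filter_upwards [hlt, hpos] with n hn hp
        have hb0 := (k n).cast_nonneg.trans_lt hn
        have hM := millsRatio_pos (k n) hb0
        have := (log_gammaTail_sub_mem (k n) hp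
          (show b n + millsRatio (k n + 1) (b n) * x ≤ b n by nlinarith)).2
        rw [show b n - (b n + millsRatio (k n + 1) (b n) * x)
          = millsRatio (k n + 1) (b n) * (-x) by ring, mul_div_cancel_left₀ _ hM.ne'] at this
        linarith
      · filter_upwards [hlt, hpos] with n hn hp
        have hb0 := (k n).cast_nonneg.trans_lt hn
        have hM := millsRatio_pos (k n) hb0
        have := (log_gammaTail_sub_mem (k n) hp
          (show b n + millsRatio (k n + 1) (b n) * x ≤ b n by nlinarith)).1
        rw [show (b n - (b n + millsRatio (k n + 1) (b n) * x)) /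
          millsRatio (k n + 1) (b n + millsRatio (k n + 1) (b n) * x)
          = -(x * (millsRatio (k n + 1) (b n) /
            millsRatio (k n + 1) (b n + millsRatio (k n + 1) (b n) * x))) by ring] at this
        linarith
  refine ((Real.continuous_exp.tendsto _).comp hL.neg).congr' ?_
  filter_upwards [hb, hpos] with n hn hp
  have hQ := gammaTail_pos (k n) hn.1
  have hQ' := gammaTail_pos (k n) hp.le
  simp only [Function.comp_apply, neg_sub]
  rw [Real.exp_sub, Real.exp_log hQ, Real.exp_log hQ', div_eq_iff hQ.ne', mul_right_comm, hn.2,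
    one_mul]

/-- With `D = b - k`, eventually `M ≥ b/(2D)`, so the quotient is at most `4D²/(b n)`. The decay of
`Q` from the midpoint `b - D/2` to `b` costs at least `D²/(4b)` in `log Q`, and only `log n` is
available since `Q(b) = 1/n`. -/
lemma tendsto_div_mul_millsRatio_sq
    (hb : ∀ᶠ n : ℕ+ in atTop, 0 ≤ b n ∧ (n : ℝ) * gammaTail (k n + 1) (b n) = 1) :
    Tendsto (fun n : ℕ+ => b n / (n * millsRatio (k n + 1) (b n) ^ 2)) atTop (𝓝 0) := by
  have hlog : Tendsto (fun n : ℕ+ => 16 * (Real.log n / n)) atTop (𝓝 0) := by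
    have h := (Real.isLittleO_log_id_atTop.tendsto_div_nhds_zero.comp tendsto_pnat_coe_atTop)
    simpa using h.const_mul 16
  have h0 := (tendsto_millsRatio_mul_div hb 0).2
  simp only [mul_zero, add_zero] at h0
  refine squeeze_zero' ?_ ?_ hlog
  · filter_upwards [hb] with n hn
    have := hn.1
    positivity
  filter_upwards [hb, eventually_lt_of_tail hb,
    h0.eventually_const_lt (show (1 / 2 : ℝ) < 1 by norm_num)] with n hn hlt hhalf
  have hk : (0 : ℝ) ≤ k n := (k n).cast_nonneg
  have hb0 : 0 < b n := hk.trans_lt hlt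
  have hn0 : (0 : ℝ) < n := by exact_mod_cast n.pos
  obtain ⟨D, hD⟩ : ∃ D, D = b n - k n := ⟨_, rfl⟩
  have hD0 : 0 < D := by linarith
  rw [← hD] at hhalf
  have hM := millsRatio_pos (k n) hb0
  have h1 : b n ≤ 2 * D * millsRatio (k n + 1) (b n) := by
    rw [← mul_div_assoc, lt_div_iff₀ hb0] at hhalf
    linarith
  have hmid : (k n : ℝ) < b n - D / 2 := by linarith
  have hmid0 : 0 < b n - D / 2 := hk.trans_lt hmid
  have h2 := (log_gammaTail_sub_mem (k n) hmid0 (show b n - D / 2 ≤ b n by linarith)).1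
  have h3 := millsRatio_le (k n) hmid
  have h4 : Real.log (gammaTail (k n + 1) (b n - D / 2)) ≤ 0 :=
    Real.log_nonpos (gammaTail_pos _ hmid0.le).le (gammaTail_le_one _ hmid0.le)
  have h5 : Real.log (gammaTail (k n + 1) (b n)) = -Real.log n := by
    rw [← Real.log_inv, eq_inv_of_mul_eq_one_right hn.2]
  have h6 : D ^ 2 / (4 * b n) ≤ Real.log n := by
    have e : b n - D / 2 - k n = D / 2 := by rw [hD]; ring
    rw [e] at h3
    have hMm := millsRatio_pos (k n) hmid0
    have h7 : D / 2 / ((b n - D / 2) / (D / 2)) ≤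
        D / 2 / millsRatio (k n + 1) (b n - D / 2) := by gcongr
    have h8 : D ^ 2 / (4 * b n) ≤ D / 2 / ((b n - D / 2) / (D / 2)) := by
      rw [show D / 2 / ((b n - D / 2) / (D / 2)) = D ^ 2 / (4 * (b n - D / 2)) by field_simp; ring]
      gcongr
      linarith
    rw [show b n - (b n - D / 2) = D / 2 by ring] at h2
    linarith
  calc b n / (n * millsRatio (k n + 1) (b n) ^ 2)
      ≤ 16 * (D ^ 2 / (4 * b n) / n) := by
        rw [div_div, ← mul_div_assoc, div_le_div_iff₀ (by positivity) (by positivity)]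
        have : b n ^ 2 ≤ (2 * D * millsRatio (k n + 1) (b n)) ^ 2 := by gcongr
        nlinarith [mul_le_mul_of_nonneg_left this hn0.le]
    _ ≤ 16 * (Real.log n / n) := by gcongr

end Asymptotics

/-! ### The Gumbel law -/

lemma hasDerivAt_exp_neg (x : ℝ) : HasDerivAt (fun x : ℝ => Real.exp (-x)) (-Real.exp (-x)) x := by
  simpa using (hasDerivAt_neg x).exp

lemma injective_exp_neg : Function.Injective fun x : ℝ => Real.exp (-x) := fun x y h => by
  simpa using h

lemma measurable_gumbelDens :
    Measurable fun x : ℝ => ENNReal.ofReal (Real.exp (-x - Real.exp (-x))) := by fun_prop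

/-- The substitution `u = e^{-x}` turns the Gumbel law into the standard exponential law. -/
lemma gumbelMeasure_apply {s : Set ℝ} (hs : MeasurableSet s) :
    gumbelMeasure s = ∫⁻ u in (fun x : ℝ => Real.exp (-x)) '' s, ENNReal.ofReal (Real.exp (-u)) := by
  rw [lintegral_image_eq_lintegral_abs_deriv_mul hs
    (fun x _ => (hasDerivAt_exp_neg x).hasDerivWithinAt) injective_exp_neg.injOn,
    gumbelMeasure, withDensity_apply _ hs]
  refine lintegral_congr fun x => ?_
  rw [abs_neg, abs_of_pos (Real.exp_pos _), ← ENNReal.ofReal_mul (Real.exp_pos _).le,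
    ← Real.exp_add, sub_eq_add_neg]

lemma lintegral_exp_neg_Ioi (c : ℝ) :
    ∫⁻ u in Set.Ioi c, ENNReal.ofReal (Real.exp (-u)) = ENNReal.ofReal (Real.exp (-c)) := by
  rw [← ofReal_integral_eq_lintegral_ofReal (integrableOn_exp_neg_Ioi c)
    (ae_of_all _ fun x => (Real.exp_pos _).le), integral_exp_neg_Ioi]

lemma image_exp_neg_univ : (fun x : ℝ => Real.exp (-x)) '' Set.univ = Set.Ioi 0 := by
  ext u
  simp only [Set.image_univ, Set.mem_range, Set.mem_Ioi]
  exact ⟨fun ⟨x, hx⟩ => hx ▸ Real.exp_pos _, fun h => ⟨-Real.log u, by simp [Real.exp_log h]⟩⟩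

instance : IsProbabilityMeasure gumbelMeasure := by
  constructor
  rw [gumbelMeasure_apply MeasurableSet.univ, image_exp_neg_univ, lintegral_exp_neg_Ioi]
  simp

lemma gumbelMeasure_Iic (x : ℝ) :
    gumbelMeasure (Set.Iic x) = ENNReal.ofReal (Real.exp (-Real.exp (-x))) := by
  have h : (fun x : ℝ => Real.exp (-x)) '' Set.Iic x = Set.Ici (Real.exp (-x)) := by
    ext u
    simp only [Set.mem_image, Set.mem_Iic, Set.mem_Ici]
    constructor
    · rintro ⟨y, hy, rfl⟩
      exact Real.exp_le_exp.2 (by linarith)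
    · intro h
      have hu : 0 < u := (Real.exp_pos _).trans_le h
      refine ⟨-Real.log u, ?_, by simp [Real.exp_log hu]⟩
      have := (Real.le_log_iff_exp_le hu).2 h
      linarith
  rw [gumbelMeasure_apply measurableSet_Iic, h, setLIntegral_congr Ioi_ae_eq_Ici.symm,
    lintegral_exp_neg_Ioi]

lemma gumbel_integrand_eq (s x : ℝ) :
    (ENNReal.ofReal (Real.exp (-x - Real.exp (-x)))).toReal • Real.exp (s * x) =
      |-Real.exp (-x)| • (Real.exp (-Real.exp (-x)) * Real.exp (-x) ^ ((1 - s) - 1)) := by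
  rw [ENNReal.toReal_ofReal (Real.exp_pos _).le, abs_neg, abs_of_pos (Real.exp_pos _),
    smul_eq_mul, smul_eq_mul, ← Real.exp_mul, ← Real.exp_add, ← Real.exp_add, ← Real.exp_add]
  congr 1
  ring

lemma integrable_exp_mul_gumbel {s : ℝ} (hs : s < 1) :
    Integrable (fun x => Real.exp (s * x)) gumbelMeasure := by
  rw [gumbelMeasure, integrable_withDensity_iff_integrable_smul' measurable_gumbelDens
    (ae_of_all _ fun _ => ENNReal.ofReal_lt_top)]
  have h := Real.GammaIntegral_convergent (show 0 < 1 - s by linarith)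
  rw [← image_exp_neg_univ, integrableOn_image_iff_integrableOn_abs_deriv_smul MeasurableSet.univ
    (fun x _ => (hasDerivAt_exp_neg x).hasDerivWithinAt) injective_exp_neg.injOn,
    integrableOn_univ] at h
  exact h.congr (ae_of_all _ fun x => (gumbel_integrand_eq s x).symm)

/-- The moment generating function of the Gumbel law is `Γ(1 - s)`. -/
lemma mgf_gumbel {s : ℝ} (hs : s < 1) : mgf id gumbelMeasure s = Real.Gamma (1 - s) := by
  rw [mgf, gumbelMeasure, integral_withDensity_eq_integral_toReal_smul measurable_gumbelDens
    (ae_of_all _ fun _ => ENNReal.ofReal_lt_top), Real.Gamma_eq_integral (by linarith),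
    ← image_exp_neg_univ, integral_image_eq_integral_abs_deriv_smul MeasurableSet.univ
    (fun x _ => (hasDerivAt_exp_neg x).hasDerivWithinAt) injective_exp_neg.injOn,
    setIntegral_univ]
  exact integral_congr_ae (ae_of_all _ fun x => gumbel_integrand_eq s x)

lemma mem_interior_integrableExpSet_gumbel {s : ℝ} (hs : s < 1) :
    s ∈ interior (integrableExpSet id gumbelMeasure) :=
  interior_mono (s := Set.Iio 1) (fun _ ht => integrable_exp_mul_gumbel ht)
    (by rwa [interior_Iio])

lemma integrable_abs_rpow_gumbel {r : ℝ} (hr : 0 ≤ r) :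
    Integrable (fun x : ℝ => |x| ^ r) gumbelMeasure :=
  integrable_rpow_abs_of_integrable_exp_mul (X := id) (t := 1 / 2) (by norm_num)
    (integrable_exp_mul_gumbel (by norm_num)) (integrable_exp_mul_gumbel (by norm_num)) hr

/-- The derivative of `Γ(1 - s)` at zero is `-Γ'(1) = γ`. -/
lemma integral_id_gumbel : ∫ x, x ∂gumbelMeasure = Real.eulerMascheroniConstant := by
  have h := deriv_mgf_zero (mem_interior_integrableExpSet_gumbel one_pos)
  have hev : mgf id gumbelMeasure =ᶠ[𝓝 0] fun s => Real.Gamma (1 - s) := by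
    filter_upwards [eventually_lt_nhds one_pos] with s hs using mgf_gumbel hs
  rw [hev.deriv_eq] at h
  have hd : DifferentiableAt ℝ Real.Gamma (1 - 0) := by
    refine Real.differentiableAt_Gamma fun k => ?_
    have : (0 : ℝ) ≤ k := k.cast_nonneg
    linarith
  have h2 : deriv (fun s : ℝ => Real.Gamma (1 - s)) 0 = -deriv Real.Gamma 1 := by
    have := deriv_comp_const_sub (f := Real.Gamma) (a := 1) (x := 0)
    simpa using this
  rw [h2, ← Real.eulerMascheroniConstant_eq_neg_deriv] at h
  simpa using h.symm

/-! ### The second Gumbel moment from the reflection formula. -/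

lemma tendsto_sin_sub_mul_cos_div_cube :
    Tendsto (fun x : ℝ => (Real.sin x - x * Real.cos x) / x ^ 3) (𝓝[≠] 0) (𝓝 (1 / 3)) := by
  have hsinc : Tendsto (fun x : ℝ => Real.sin x / x) (𝓝[≠] 0) (𝓝 1) := by
    have := (Real.hasDerivAt_sin 0).tendsto_slope
    simpa [slope_fun_def_field] using this
  refine HasDerivAt.lhopital_zero_nhdsNE (f' := fun x => x * Real.sin x)
    (g' := fun x => 3 * x ^ 2) ?_ ?_ ?_ ?_ ?_ ?_
  · refine Eventually.of_forall fun x => ?_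
    refine ((Real.hasDerivAt_sin x).sub ((hasDerivAt_id x).mul (Real.hasDerivAt_cos x))).congr_deriv
      ?_
    simp
  · exact Eventually.of_forall fun x => by simpa using hasDerivAt_pow 3 x
  · filter_upwards [self_mem_nhdsWithin] with x hx
    have : x ≠ 0 := hx
    positivity
  · have : Continuous fun x : ℝ => Real.sin x - x * Real.cos x := by fun_prop
    simpa using (this.tendsto 0).mono_left nhdsWithin_le_nhds
  · have : Continuous fun x : ℝ => x ^ 3 := by fun_prop
    simpa using (this.tendsto 0).mono_left nhdsWithin_le_nhds
  · refine ((hsinc.div_const 3)).congr' ?_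
    filter_upwards [self_mem_nhdsWithin] with x hx
    have : x ≠ 0 := hx
    field_simp

/-- The second derivative at zero of `πs / sin πs`, read off from its first derivative. -/
lemma tendsto_deriv_pi_mul_div_sin :
    Tendsto (fun s : ℝ => Real.pi * (Real.sin (Real.pi * s) -
      Real.pi * s * Real.cos (Real.pi * s)) / Real.sin (Real.pi * s) ^ 2 / s) (𝓝[≠] 0)
      (𝓝 (Real.pi ^ 2 / 3)) := by
  have hsinc : Tendsto (fun x : ℝ => Real.sin x / x) (𝓝[≠] 0) (𝓝 1) := by
    have := (Real.hasDerivAt_sin 0).tendsto_slope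
    simpa [slope_fun_def_field] using this
  have hpi : Tendsto (fun s : ℝ => Real.pi * s) (𝓝[≠] 0) (𝓝[≠] 0) := by
    refine tendsto_nhdsWithin_iff.2 ⟨?_, ?_⟩
    · have : Continuous fun s : ℝ => Real.pi * s := by fun_prop
      simpa using (this.tendsto 0).mono_left nhdsWithin_le_nhds
    · filter_upwards [self_mem_nhdsWithin] with s hs
      exact mul_ne_zero Real.pi_ne_zero hs
  have h := ((tendsto_sin_sub_mul_cos_div_cube.div (hsinc.pow 2) (by norm_num)).comp hpi).const_mul
    (Real.pi ^ 2)
  refine (h.congr' ?_).trans (by norm_num [div_eq_mul_inv])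
  have hs0 : ∀ᶠ s : ℝ in 𝓝[≠] 0, Real.sin (Real.pi * s) ≠ 0 := by
    have h1 := (hsinc.comp hpi).eventually_ne one_ne_zero
    filter_upwards [h1] with s hs h0
    simp [h0] at hs
  filter_upwards [self_mem_nhdsWithin, hs0] with s hs hs'
  have : s ≠ 0 := hs
  have hpi0 := Real.pi_ne_zero
  simp only [Function.comp_apply, Pi.div_apply]
  field_simp

lemma mgf_gumbel_mul_mgf_neg {s : ℝ} (h0 : s ≠ 0) (h1 : |s| < 1) :
    mgf id gumbelMeasure s * mgf id gumbelMeasure (-s) =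
      Real.pi * s / Real.sin (Real.pi * s) := by
  rw [mgf_gumbel (abs_lt.1 h1).2, mgf_gumbel (by linarith [(abs_lt.1 h1).1]), sub_neg_eq_add,
    add_comm 1 s, Real.Gamma_add_one h0]
  have := Real.Gamma_mul_Gamma_one_sub s
  calc _ = s * (Real.Gamma s * Real.Gamma (1 - s)) := by ring
    _ = _ := by rw [this]; ring

/-- The product `φ(t) = M(t) M(-t)` has `φ''(0) = 2 (E X² - (E X)²)`. It equals `πt / sin πt` near
zero, whose second derivative there is `π²/3`. Thus the variance appears without computing `Γ''(1)`.
-/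
lemma integral_sq_gumbel :
    ∫ x, x ^ 2 ∂gumbelMeasure = Real.pi ^ 2 / 6 + Real.eulerMascheroniConstant ^ 2 := by
  set M := mgf id gumbelMeasure with hM
  set M1 : ℝ → ℝ := fun t => ∫ x, x ^ 1 * Real.exp (t * x) ∂gumbelMeasure with hM1
  set M2 : ℝ → ℝ := fun t => ∫ x, x ^ 2 * Real.exp (t * x) ∂gumbelMeasure with hM2
  have d0 : ∀ t < 1, HasDerivAt M (M1 t) t := fun t ht =>
    (hasDerivAt_mgf (mem_interior_integrableExpSet_gumbel ht)).congr_deriv (by simp [hM1])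
  have d1 : ∀ t < 1, HasDerivAt M1 (M2 t) t := fun t ht =>
    hasDerivAt_integral_pow_mul_exp_real (X := id) (mem_interior_integrableExpSet_gumbel ht) 1
  have hneg : ∀ (F : ℝ → ℝ) (F' t : ℝ), HasDerivAt F F' (-t) →
      HasDerivAt (fun t => F (-t)) (-F') t := fun F F' t h =>
    (h.comp t (hasDerivAt_neg t)).congr_deriv (by simp)
  set φ' : ℝ → ℝ := fun t => M1 t * M (-t) - M t * M1 (-t) with hφ'
  have dφ : ∀ t, |t| < 1 → HasDerivAt (fun t => M t * M (-t)) (φ' t) t := fun t ht => by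
    refine ((d0 t (abs_lt.1 ht).2).mul (hneg M _ t (d0 (-t) (by linarith [(abs_lt.1 ht).1])))
      ).congr_deriv ?_
    simp only [hφ']; ring
  have M0 : M 0 = 1 := by simp [hM]
  have dφ' : HasDerivAt φ' (2 * M2 0 - 2 * M1 0 ^ 2) 0 := by
    have e0 := d0 0 one_pos
    have e1 := d1 0 one_pos
    have f0 := hneg M (M1 0) 0 (by simpa using e0)
    have f1 := hneg M1 (M2 0) 0 (by simpa using e1)
    refine ((e1.mul f0).sub (e0.mul f1)).congr_deriv ?_
    simp only [neg_zero, M0]; ring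
  have hφ0 : φ' 0 = 0 := by simp only [hφ', neg_zero]; ring
  -- The formula `πs / sin πs` has the wrong value at `s = 0` under division by zero, so `φ''(0)` is
  -- obtained as the limit of `φ'(s)/s` over `s ≠ 0`.
  have hlim : Tendsto (fun s => φ' s / s) (𝓝[≠] 0) (𝓝 (2 * M2 0 - 2 * M1 0 ^ 2)) := by
    have := dφ'.tendsto_slope
    simpa [slope_fun_def_field, hφ0] using this
  have hlim' : Tendsto (fun s => φ' s / s) (𝓝[≠] 0) (𝓝 (Real.pi ^ 2 / 3)) := by
    refine tendsto_deriv_pi_mul_div_sin.congr' ?_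
    have hball : ∀ᶠ s : ℝ in 𝓝[≠] 0, |s| < 1 :=
      nhdsWithin_le_nhds (by
        simpa [Metric.ball, Real.dist_eq] using Metric.ball_mem_nhds (0 : ℝ) one_pos)
    filter_upwards [self_mem_nhdsWithin, hball] with s hs hs1
    have hs0 : s ≠ 0 := hs
    -- A zero of the sine would make the quotient zero by convention, whereas the product of the two
    -- Gamma values is positive.
    have hsin : Real.sin (Real.pi * s) ≠ 0 := by
      intro h0
      have h1 := mgf_gumbel_mul_mgf_neg hs0 hs1
      rw [h0, div_zero, mgf_gumbel (abs_lt.1 hs1).2,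
        mgf_gumbel (by linarith [(abs_lt.1 hs1).1])] at h1
      have h2 := Real.Gamma_pos_of_pos (show 0 < 1 - s by linarith [(abs_lt.1 hs1).2])
      have h3 := Real.Gamma_pos_of_pos (show 0 < 1 - -s by linarith [(abs_lt.1 hs1).1])
      nlinarith
    have hpiD : HasDerivAt (fun s : ℝ => Real.pi * s) Real.pi s := by
      simpa using (hasDerivAt_id s).const_mul Real.pi
    have hD := hpiD.div hpiD.sin hsin
    have hev : (fun t => M t * M (-t)) =ᶠ[𝓝 s]
        (fun s => Real.pi * s) / fun s => Real.sin (Real.pi * s) := by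
      have h1 : ∀ᶠ t in 𝓝 s, t ≠ 0 := eventually_ne_nhds hs0
      have h2 : ∀ᶠ t in 𝓝 s, |t| < 1 := (continuous_abs.tendsto s).eventually_lt_const hs1
      filter_upwards [h1, h2] with t ht ht' using mgf_gumbel_mul_mgf_neg ht ht'
    have := (dφ s hs1).unique (hD.congr_of_eventuallyEq hev)
    rw [this]
    congr 1
    ring
  have huniq := tendsto_nhds_unique hlim hlim'
  have hM10 : M1 0 = Real.eulerMascheroniConstant := by
    simp only [hM1, zero_mul, Real.exp_zero, mul_one, pow_one]
    exact integral_id_gumbel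
  have hM20 : M2 0 = ∫ x, x ^ 2 ∂gumbelMeasure := by simp [hM2]
  rw [hM10, hM20] at huniq
  linarith

/-! ### Convergence of moments from convergence of distribution functions -/

lemma abs_rpow_eq_add {r : ℝ} (hr : 0 < r) (x : ℝ) :
    |x| ^ r = (max x 0) ^ r + (max (-x) 0) ^ r := by
  rcases le_total 0 x with h | h
  · rw [abs_of_nonneg h, max_eq_left h, max_eq_right (by linarith), Real.zero_rpow hr.ne', add_zero]
  · rw [abs_of_nonpos h, max_eq_right h, max_eq_left (by linarith), Real.zero_rpow hr.ne', zero_add]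

lemma lintegral_max_rpow (ν : Measure ℝ) {r : ℝ} (hr : 0 < r) :
    ∫⁻ x, ENNReal.ofReal ((max x 0) ^ r) ∂ν =
      ENNReal.ofReal r * ∫⁻ t in Set.Ioi 0, ν (Set.Ioi t) * ENNReal.ofReal (t ^ (r - 1)) := by
  rw [lintegral_rpow_eq_lintegral_meas_lt_mul ν (ae_of_all _ fun x => le_max_right x 0)
    (by fun_prop) hr]
  congr 1
  refine setLIntegral_congr_fun measurableSet_Ioi fun t ht => ?_
  have ht' : ¬ t < 0 := not_lt.2 (le_of_lt ht)
  simp only [lt_max_iff, ht', or_false]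
  rfl

lemma lintegral_max_neg_rpow (ν : Measure ℝ) {r : ℝ} (hr : 0 < r) :
    ∫⁻ x, ENNReal.ofReal ((max (-x) 0) ^ r) ∂ν =
      ENNReal.ofReal r * ∫⁻ t in Set.Ioi 0, ν (Set.Iic (-t)) * ENNReal.ofReal (t ^ (r - 1)) := by
  rw [lintegral_rpow_eq_lintegral_meas_le_mul ν (ae_of_all _ fun x => le_max_right (-x) 0)
    (by fun_prop) hr]
  congr 1
  refine setLIntegral_congr_fun measurableSet_Ioi fun t ht => ?_
  have ht' : ¬ t ≤ 0 := not_le.2 ht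
  simp only [le_max_iff, ht', or_false, le_neg]
  rfl

section MomentConvergence

variable {ι : Type*} {l : Filter ι} [l.IsCountablyGenerated]

/-- Dominated convergence with the integrable majorant `e^{-t} t^{r-1}`; monotonicity of the tails
supplies their measurability. -/
lemma tendsto_lintegral_tail_mul {F : ι → ℝ → ℝ≥0∞} {F₀ : ℝ → ℝ≥0∞} {r : ℝ} (hr : 0 < r)
    (hanti : ∀ i, Antitone (F i))
    (hbound : ∀ᶠ i in l, ∀ t, 0 ≤ t → F i t ≤ ENNReal.ofReal (Real.exp (-t)))
    (hlim : ∀ t, Tendsto (fun i => F i t) l (𝓝 (F₀ t))) :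
    Tendsto (fun i => ENNReal.ofReal r *
        ∫⁻ t in Set.Ioi 0, F i t * ENNReal.ofReal (t ^ (r - 1))) l
      (𝓝 (ENNReal.ofReal r * ∫⁻ t in Set.Ioi 0, F₀ t * ENNReal.ofReal (t ^ (r - 1)))) := by
  refine ENNReal.Tendsto.const_mul ?_ (Or.inr ENNReal.ofReal_ne_top)
  refine tendsto_lintegral_filter_of_dominated_convergence
    (fun t => ENNReal.ofReal (Real.exp (-t) * t ^ (r - 1))) ?_ ?_ ?_ ?_
  · exact Eventually.of_forall fun i => (hanti i).measurable.mul (by fun_prop)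
  · filter_upwards [hbound] with i hi
    filter_upwards [self_mem_ae_restrict measurableSet_Ioi] with t ht
    rw [ENNReal.ofReal_mul (Real.exp_pos _).le]
    gcongr
    exact hi t (le_of_lt ht)
  · exact (Real.GammaIntegral_convergent hr).lintegral_lt_top.ne
  · exact ae_of_all _ fun t =>
      ENNReal.Tendsto.mul_const (hlim t) (Or.inr ENNReal.ofReal_ne_top)

variable {ν : ι → Measure ℝ} {μ : Measure ℝ}

lemma integral_eq_toReal_lintegral_rpow (ν : Measure ℝ) {g : ℝ → ℝ} (hg : Measurable g)
    (h0 : ∀ x, 0 ≤ g x) (r : ℝ) :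
    ∫ x, (g x) ^ r ∂ν = (∫⁻ x, ENNReal.ofReal ((g x) ^ r) ∂ν).toReal :=
  integral_eq_lintegral_of_nonneg_ae (ae_of_all _ fun x => Real.rpow_nonneg (h0 x) r)
    (hg.pow_const r).aestronglyMeasurable

lemma lintegral_rpow_ne_top {ν : Measure ℝ} {g : ℝ → ℝ} (hg : ∀ x, 0 ≤ g x ∧ g x ≤ |x|) {r : ℝ}
    (hr : 0 < r) (h : Integrable (fun x => |x| ^ r) ν) :
    ∫⁻ x, ENNReal.ofReal ((g x) ^ r) ∂ν ≠ ∞ := by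
  refine ne_top_of_le_ne_top h.lintegral_lt_top.ne (lintegral_mono fun x => ?_)
  exact ENNReal.ofReal_le_ofReal (Real.rpow_le_rpow (hg x).1 (hg x).2 hr.le)

lemma tendsto_integral_max_neg_rpow {r : ℝ} (hr : 0 < r)
    (hcdf : ∀ x, Tendsto (fun i => ν i (Set.Iic x)) l (𝓝 (μ (Set.Iic x))))
    (hlow : ∀ᶠ i in l, ∀ t, 0 ≤ t → ν i (Set.Iic (-t)) ≤ ENNReal.ofReal (Real.exp (-t)))
    (hμ : Integrable (fun x => |x| ^ r) μ) :
    Tendsto (fun i => ∫ x, (max (-x) 0) ^ r ∂(ν i)) l (𝓝 (∫ x, (max (-x) 0) ^ r ∂μ)) := by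
  have hm : Measurable fun x : ℝ => max (-x) 0 := by fun_prop
  simp only [integral_eq_toReal_lintegral_rpow _ hm (fun x => le_max_right (-x) 0)]
  refine (ENNReal.tendsto_toReal (lintegral_rpow_ne_top
    (fun x => ⟨le_max_right _ _, max_le (neg_le_abs x) (abs_nonneg x)⟩) hr hμ)).comp ?_
  simp only [lintegral_max_neg_rpow _ hr]
  exact tendsto_lintegral_tail_mul hr
    (fun i s t hst => measure_mono (Set.Iic_subset_Iic.2 (neg_le_neg hst))) hlow
    fun t => hcdf (-t)

variable [∀ i, IsProbabilityMeasure (ν i)] [IsProbabilityMeasure μ]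

lemma tendsto_integral_max_rpow {r : ℝ} (hr : 0 < r)
    (hcdf : ∀ x, Tendsto (fun i => ν i (Set.Iic x)) l (𝓝 (μ (Set.Iic x))))
    (hup : ∀ᶠ i in l, ∀ t, 0 ≤ t → ν i (Set.Ioi t) ≤ ENNReal.ofReal (Real.exp (-t)))
    (hμ : Integrable (fun x => |x| ^ r) μ) :
    Tendsto (fun i => ∫ x, (max x 0) ^ r ∂(ν i)) l (𝓝 (∫ x, (max x 0) ^ r ∂μ)) := by
  have hm : Measurable fun x : ℝ => max x 0 := by fun_prop
  simp only [integral_eq_toReal_lintegral_rpow _ hm (fun x => le_max_right x 0)]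
  refine (ENNReal.tendsto_toReal (lintegral_rpow_ne_top
    (fun x => ⟨le_max_right _ _, max_le (le_abs_self x) (abs_nonneg x)⟩) hr hμ)).comp ?_
  simp only [lintegral_max_rpow _ hr]
  refine tendsto_lintegral_tail_mul hr (fun i s t hst => measure_mono (Set.Ioi_subset_Ioi hst))
    hup fun t => ?_
  have h : ∀ (ρ : Measure ℝ) [IsProbabilityMeasure ρ], ρ (Set.Ioi t) = 1 - ρ (Set.Iic t) := by
    intro ρ _
    rw [← Set.compl_Iic, prob_compl_eq_one_sub measurableSet_Iic]
  simp only [h]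
  exact ENNReal.Tendsto.sub tendsto_const_nhds (hcdf t) (Or.inl ENNReal.one_ne_top)

lemma integrable_max_rpow {ν : Measure ℝ} {g : ℝ → ℝ} (hm : Measurable g)
    (hg : ∀ x, 0 ≤ g x ∧ g x ≤ |x|) {r : ℝ}
    (hr : 0 < r) (h : Integrable (fun x => |x| ^ r) ν) : Integrable (fun x => (g x) ^ r) ν :=
  h.mono' (hm.pow_const r).aestronglyMeasurable (ae_of_all _ fun x => by
    rw [Real.norm_of_nonneg (Real.rpow_nonneg (hg x).1 r)]
    exact Real.rpow_le_rpow (hg x).1 (hg x).2 hr.le)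

lemma max_zero_mem (x : ℝ) : 0 ≤ max x 0 ∧ max x 0 ≤ |x| :=
  ⟨le_max_right _ _, max_le (le_abs_self x) (abs_nonneg x)⟩

lemma max_neg_zero_mem (x : ℝ) : 0 ≤ max (-x) 0 ∧ max (-x) 0 ≤ |x| :=
  ⟨le_max_right _ _, max_le (neg_le_abs x) (abs_nonneg x)⟩

lemma integral_abs_rpow_eq_add {ν : Measure ℝ} {r : ℝ} (hr : 0 < r)
    (h : Integrable (fun x => |x| ^ r) ν) :
    ∫ x, |x| ^ r ∂ν = ∫ x, (max x 0) ^ r ∂ν + ∫ x, (max (-x) 0) ^ r ∂ν := by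
  rw [← integral_add (integrable_max_rpow (by fun_prop) max_zero_mem hr h)
    (integrable_max_rpow (by fun_prop) max_neg_zero_mem hr h)]
  simp only [abs_rpow_eq_add hr]

lemma integral_id_eq_sub {ν : Measure ℝ} (h : Integrable (fun x => |x| ^ (1 : ℝ)) ν) :
    ∫ x, x ∂ν = ∫ x, (max x 0) ^ (1 : ℝ) ∂ν - ∫ x, (max (-x) 0) ^ (1 : ℝ) ∂ν := by
  rw [← integral_sub (integrable_max_rpow (by fun_prop) max_zero_mem one_pos h)
    (integrable_max_rpow (by fun_prop) max_neg_zero_mem one_pos h)]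
  refine integral_congr_ae (ae_of_all _ fun x => ?_)
  simp only [Real.rpow_one]
  rcases le_total 0 x with h | h
  · rw [max_eq_left h, max_eq_right (by linarith), sub_zero]
  · rw [max_eq_right h, max_eq_left (by linarith)]; ring

/-- Absolute moments converge when the distribution functions do and both tails are uniformly
exponentially small. -/
theorem tendsto_integral_abs_rpow {r : ℝ} (hr : 0 < r)
    (hcdf : ∀ x, Tendsto (fun i => ν i (Set.Iic x)) l (𝓝 (μ (Set.Iic x))))
    (hup : ∀ᶠ i in l, ∀ t, 0 ≤ t → ν i (Set.Ioi t) ≤ ENNReal.ofReal (Real.exp (-t)))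
    (hlow : ∀ᶠ i in l, ∀ t, 0 ≤ t → ν i (Set.Iic (-t)) ≤ ENNReal.ofReal (Real.exp (-t)))
    (hν : ∀ i, Integrable (fun x => |x| ^ r) (ν i)) (hμ : Integrable (fun x => |x| ^ r) μ) :
    Tendsto (fun i => ∫ x, |x| ^ r ∂(ν i)) l (𝓝 (∫ x, |x| ^ r ∂μ)) := by
  rw [integral_abs_rpow_eq_add hr hμ]
  simp only [fun i => integral_abs_rpow_eq_add hr (hν i)]
  exact (tendsto_integral_max_rpow hr hcdf hup hμ).add
    (tendsto_integral_max_neg_rpow hr hcdf hlow hμ)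

theorem tendsto_integral_id
    (hcdf : ∀ x, Tendsto (fun i => ν i (Set.Iic x)) l (𝓝 (μ (Set.Iic x))))
    (hup : ∀ᶠ i in l, ∀ t, 0 ≤ t → ν i (Set.Ioi t) ≤ ENNReal.ofReal (Real.exp (-t)))
    (hlow : ∀ᶠ i in l, ∀ t, 0 ≤ t → ν i (Set.Iic (-t)) ≤ ENNReal.ofReal (Real.exp (-t)))
    (hν : ∀ i, Integrable (fun x => |x| ^ (1 : ℝ)) (ν i))
    (hμ : Integrable (fun x => |x| ^ (1 : ℝ)) μ) :
    Tendsto (fun i => ∫ x, x ∂(ν i)) l (𝓝 (∫ x, x ∂μ)) := by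
  rw [integral_id_eq_sub hμ]
  simp only [fun i => integral_id_eq_sub (hν i)]
  exact (tendsto_integral_max_rpow one_pos hcdf hup hμ).sub
    (tendsto_integral_max_neg_rpow one_pos hcdf hlow hμ)

end MomentConvergence

/-! ### The law of the Poissonized completion time -/

lemma poissonMeasure_setOf_lt (m : ℕ) (t : ℝ≥0) :
    poissonMeasure t {j | j < m} = ENNReal.ofReal (gammaTail m t) := by
  have h : {j : ℕ | j < m} = ↑(Finset.range m) := by ext; simp
  rw [h, ← sum_measure_singleton]
  simp only [poissonMeasure_singleton]
  rw [← ENNReal.ofReal_sum_of_nonneg fun j _ => by positivity, gammaTail, Finset.mul_sum]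
  simp only [mul_div_assoc]

lemma poissonMeasure_setOf_le (m : ℕ) (t : ℝ≥0) :
    poissonMeasure t {j | m ≤ j} = ENNReal.ofReal (1 - gammaTail m t) := by
  have h : {j : ℕ | m ≤ j} = {j | j < m}ᶜ := by ext; simp
  have h0 : 0 ≤ gammaTail m t := by unfold gammaTail; positivity
  rw [h, prob_compl_eq_one_sub .of_discrete, poissonMeasure_setOf_lt, ENNReal.ofReal_sub _ h0,
    ENNReal.ofReal_one]

lemma poissonTime_nonneg {Ω : Type*} {n : ℕ} (m : ℕ) (N : Fin n → ℝ≥0 → Ω → ℕ) (ω : Ω) :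
    0 ≤ poissonTime m N ω :=
  NNReal.coe_nonneg _

section PoissonTime

variable {Ω : Type*} [MeasurableSpace Ω] {P : Measure Ω}

lemma IsUnitPoissonProcess.map_eq {N : ℝ≥0 → Ω → ℕ} (h : IsUnitPoissonProcess N P) (t : ℝ≥0) :
    P.map (N t) = poissonMeasure t := by
  have := h.law 0 t zero_le
  rw [tsub_zero] at this
  rw [← this]
  refine Measure.map_congr ?_
  filter_upwards [h.zero] with ω hω
  simp [hω]

lemma IsUnitPoissonProcess.measure_le {N : ℝ≥0 → Ω → ℕ} (h : IsUnitPoissonProcess N P) (m : ℕ)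
    (t : ℝ≥0) : P {ω | m ≤ N t ω} = ENNReal.ofReal (1 - gammaTail m t) := by
  rw [← poissonMeasure_setOf_le, ← h.map_eq t, Measure.map_apply (h.measurable t) .of_discrete]
  rfl

lemma IsUnitPoissonProcess.measure_lt {N : ℝ≥0 → Ω → ℕ} (h : IsUnitPoissonProcess N P) (m : ℕ)
    (t : ℝ≥0) : P {ω | N t ω < m} = ENNReal.ofReal (gammaTail m t) := by
  rw [← poissonMeasure_setOf_lt, ← h.map_eq t, Measure.map_apply (h.measurable t) .of_discrete]
  rfl

lemma tendsto_exp_neg_half_nat (c : ℝ) :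
    Tendsto (fun k : ℕ => c * Real.exp (-((k : ℝ) / 2))) atTop (𝓝 0) := by
  have h : Tendsto (fun k : ℕ => -((k : ℝ) / 2)) atTop atBot :=
    tendsto_neg_atTop_atBot.comp (tendsto_natCast_atTop_atTop.atTop_div_const (by norm_num))
  simpa using (Real.tendsto_exp_atBot.comp h).const_mul c

lemma IsUnitPoissonProcess.ae_exists_le {N : ℝ≥0 → Ω → ℕ} (h : IsUnitPoissonProcess N P) (m : ℕ) :
    ∀ᵐ ω ∂P, ∃ t, m ≤ N t ω := by
  rw [ae_iff]
  have hle : ∀ k : ℕ, P {ω | ¬ ∃ t, m ≤ N t ω} ≤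
      ENNReal.ofReal (2 ^ m * Real.exp (-((k : ℝ) / 2))) := fun k => by
    calc P {ω | ¬ ∃ t, m ≤ N t ω} ≤ P {ω | N k ω < m} :=
          measure_mono fun ω hω => by
            simp only [Set.mem_ofPred_eq, not_exists, not_le] at hω ⊢
            exact hω k
      _ ≤ _ := by
          rw [h.measure_lt]
          exact ENNReal.ofReal_le_ofReal (gammaTail_le_two_pow_mul_exp m (NNReal.coe_nonneg _))
  have hlim := ENNReal.tendsto_ofReal (tendsto_exp_neg_half_nat (2 ^ m))
  rw [ENNReal.ofReal_zero] at hlim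
  exact le_antisymm (ge_of_tendsto' hlim hle) zero_le

variable {n : ℕ} {N : Fin n → ℝ≥0 → Ω → ℕ}

/-- Right-continuity of the integer-valued paths makes the infimum attained, and monotonicity makes
the set of completion times an up-set. -/
lemma AreIIDUnitPoisson.ae_poissonTime_le_iff (hN : AreIIDUnitPoisson N P) (m : ℕ) :
    ∀ᵐ ω ∂P, ∀ t : ℝ≥0, poissonTime m N ω ≤ t ↔ ∀ i, m ≤ N i t ω := by
  have h1 := ae_all_iff.2 fun i => (hN.poisson i).mono
  have h2 := ae_all_iff.2 fun i => (hN.poisson i).rightCts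
  have h3 := ae_all_iff.2 fun i => (hN.poisson i).ae_exists_le m
  filter_upwards [h1, h2, h3] with ω hmono hcts hex t
  set S : Set ℝ≥0 := {t | ∀ i, m ≤ N i t ω} with hS
  have hup : ∀ s ∈ S, ∀ t, s ≤ t → t ∈ S := fun s hs t hst i => (hs i).trans (hmono i hst)
  choose u hu using hex
  -- Nonemptiness matters because the infimum of the empty set is zero. The sum of the individual
  -- times dominates each of them, also when `n = 0`.
  have hne : S.Nonempty := ⟨∑ i, u i, fun i => (hu i).trans (hmono i
    (Finset.single_le_sum (f := u) (fun _ _ => zero_le) (Finset.mem_univ i)))⟩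
  have hmem : sInf S ∈ S := by
    intro i
    have hev : ∀ᶠ x in 𝓝[Set.Ici (sInf S)] (sInf S), N i x ω = N i (sInf S) ω := by
      have := hcts i (sInf S)
      rw [ContinuousWithinAt, nhds_discrete, tendsto_pure] at this
      exact this
    rw [eventually_nhdsWithin_iff] at hev
    have hfr := mem_closure_iff_frequently.1 (csInf_mem_closure hne (OrderBot.bddBelow S))
    obtain ⟨x, hxS, hx⟩ := (hfr.and_eventually hev).exists
    rw [← hx (csInf_le' hxS)]
    exact hxS i
  have hdef : poissonTime m N ω = ((sInf S : ℝ≥0) : ℝ) := rfl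
  rw [hdef, NNReal.coe_le_coe]
  exact ⟨fun h => hup _ hmem t h, fun h => csInf_le' h⟩

lemma AreIIDUnitPoisson.measure_forall_le (hN : AreIIDUnitPoisson N P) {m : ℕ}
    (t : ℝ≥0) : P {ω | ∀ i, m ≤ N i t ω} = ENNReal.ofReal (1 - gammaTail m t) ^ n := by
  have h := hN.indep.measure_inter_preimage_eq_mul Finset.univ
    (sets := fun _ => {f : ℝ≥0 → ℕ | m ≤ f t})
    (fun i _ => measurable_pi_apply t (.of_discrete (s := {j : ℕ | m ≤ j})))
  have e : ⋂ i ∈ Finset.univ, (fun (ω : Ω) (t : ℝ≥0) => N i t ω) ⁻¹' {f : ℝ≥0 → ℕ | m ≤ f t}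
      = {ω | ∀ i, m ≤ N i t ω} := by ext; simp
  rw [e] at h
  have e2 : ∀ i, P ((fun (ω : Ω) (t : ℝ≥0) => N i t ω) ⁻¹' {f : ℝ≥0 → ℕ | m ≤ f t})
      = ENNReal.ofReal (1 - gammaTail m t) := fun i => (hN.poisson i).measure_le m t
  rw [h, Finset.prod_congr rfl fun i _ => e2 i, Finset.prod_const, Finset.card_univ,
    Fintype.card_fin]

/-- The distribution function of the Poissonized completion time. -/
lemma AreIIDUnitPoisson.measure_poissonTime_le (hN : AreIIDUnitPoisson N P) (k : ℕ) {t : ℝ}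
    (ht : 0 ≤ t) :
    P {ω | poissonTime (k + 1) N ω ≤ t} = ENNReal.ofReal ((1 - gammaTail (k + 1) t) ^ n) := by
  have hF : 0 ≤ 1 - gammaTail (k + 1) t := by linarith [gammaTail_le_one k ht]
  rw [ENNReal.ofReal_pow hF]
  lift t to ℝ≥0 using ht
  rw [← hN.measure_forall_le t]
  refine measure_congr ?_
  filter_upwards [hN.ae_poissonTime_le_iff (k + 1)] with ω hω
  exact propext (hω t)

lemma measure_poissonTime_le_of_neg (m : ℕ) (N : Fin n → ℝ≥0 → Ω → ℕ) {t : ℝ} (ht : t < 0) :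
    P {ω | poissonTime m N ω ≤ t} = 0 := by
  have : {ω | poissonTime m N ω ≤ t} = ∅ := by
    ext ω
    simpa using ht.trans_le (poissonTime_nonneg m N ω)
  rw [this, measure_empty]

lemma AreIIDUnitPoisson.aemeasurable_poissonTime (hN : AreIIDUnitPoisson N P) (m : ℕ) :
    AEMeasurable (poissonTime m N) P := by
  -- Events for the completion time agree with measurable ones only almost surely, so measurability
  -- is first proved for the completed σ-algebra.
  have h : NullMeasurable (poissonTime m N) P := by
    refine measurable_of_Iic (δ := NullMeasurableSpace Ω P) fun t => ?_
    change NullMeasurableSet {ω | poissonTime m N ω ≤ t} P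
    rcases lt_or_ge t 0 with ht | ht
    · have : {ω | poissonTime m N ω ≤ t} = ∅ := by
        ext ω
        simpa using ht.trans_le (poissonTime_nonneg m N ω)
      rw [this]
      exact nullMeasurableSet_empty
    lift t to ℝ≥0 using ht
    have hm : MeasurableSet {ω | ∀ i, m ≤ N i t ω} := by
      rw [Set.ofPred_forall]
      exact MeasurableSet.iInter fun i =>
        (hN.poisson i).measurable t (.of_discrete (s := {j : ℕ | m ≤ j}))
    refine hm.nullMeasurableSet.congr ?_
    filter_upwards [hN.ae_poissonTime_le_iff m] with ω hω
    exact propext (hω t).symm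
  exact h.aemeasurable

variable [IsProbabilityMeasure P]

lemma AreIIDUnitPoisson.measure_lt_poissonTime (hN : AreIIDUnitPoisson N P) (k : ℕ) {t : ℝ}
    (ht : 0 ≤ t) :
    P {ω | t < poissonTime (k + 1) N ω} =
      ENNReal.ofReal (1 - (1 - gammaTail (k + 1) t) ^ n) := by
  have hF : 0 ≤ 1 - gammaTail (k + 1) t := by linarith [gammaTail_le_one k ht]
  have e : {ω | t < poissonTime (k + 1) N ω} = {ω | poissonTime (k + 1) N ω ≤ t}ᶜ := by ext; simp
  have hm : NullMeasurableSet {ω | poissonTime (k + 1) N ω ≤ t} P :=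
    (hN.aemeasurable_poissonTime (k + 1)).nullMeasurable measurableSet_Iic
  rw [e, prob_compl_eq_one_sub₀ hm, hN.measure_poissonTime_le k ht, ENNReal.ofReal_sub _ (by positivity),
    ENNReal.ofReal_one]

lemma one_sub_pow_le_mul_gammaTail (n k : ℕ) {t : ℝ} (ht : 0 ≤ t) :
    1 - (1 - gammaTail (k + 1) t) ^ n ≤ n * gammaTail (k + 1) t := by
  have := one_add_mul_le_pow (a := -gammaTail (k + 1) t)
    (by linarith [gammaTail_le_one k ht]) n
  rw [← sub_eq_add_neg] at this
  linarith

lemma AreIIDUnitPoisson.memLp_poissonTime (hN : AreIIDUnitPoisson N P) (k : ℕ) {r : ℝ}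
    (hr : 0 < r) : MemLp (poissonTime (k + 1) N) (ENNReal.ofReal r) P := by
  have hm := hN.aemeasurable_poissonTime (k + 1)
  rw [← integrable_norm_rpow_iff hm.aestronglyMeasurable (by simpa using hr)
    ENNReal.ofReal_ne_top, ENNReal.toReal_ofReal hr.le]
  have hnn : ∀ ω, 0 ≤ poissonTime (k + 1) N ω := poissonTime_nonneg _ _
  simp only [Real.norm_of_nonneg (hnn _)]
  refine ⟨(hm.pow_const r).aestronglyMeasurable, ?_⟩
  rw [hasFiniteIntegral_iff_ofReal (ae_of_all _ fun ω => Real.rpow_nonneg (hnn ω) r),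
    lintegral_rpow_eq_lintegral_meas_lt_mul P (ae_of_all _ hnn) hm hr]
  refine ENNReal.mul_lt_top ENNReal.ofReal_lt_top ?_
  have hint : IntegrableOn (fun t : ℝ => n * 2 ^ (k + 1) *
      (t ^ (r - 1) * Real.exp (-(1 / 2) * t))) (Set.Ioi 0) := by
    refine Integrable.const_mul ?_ _
    have := integrableOn_rpow_mul_exp_neg_mul_rpow (p := 1) (s := r - 1) (b := 1 / 2)
      (by linarith) one_pos (by norm_num)
    simpa only [Real.rpow_one, IntegrableOn] using this
  refine lt_of_le_of_lt (setLIntegral_mono' measurableSet_Ioi fun t ht => ?_)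
    hint.lintegral_lt_top
  have ht' : (0 : ℝ) ≤ t := le_of_lt ht
  rw [hN.measure_lt_poissonTime k ht', ← ENNReal.ofReal_mul' (Real.rpow_nonneg ht' _)]
  refine ENNReal.ofReal_le_ofReal ?_
  have h1 := one_sub_pow_le_mul_gammaTail n k ht'
  have h2 := gammaTail_le_two_pow_mul_exp (k + 1) ht'
  have h3 : (0 : ℝ) ≤ t ^ (r - 1) := Real.rpow_nonneg ht' _
  calc _ ≤ n * (2 ^ (k + 1) * Real.exp (-(t / 2))) * t ^ (r - 1) := by
        gcongr
        exact h1.trans (by gcongr)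
    _ = _ := by
      rw [show -(1 / 2) * t = -(t / 2) by ring]
      ring

lemma AreIIDUnitPoisson.memLp_scaled (hN : AreIIDUnitPoisson N P) (k : ℕ) (b a : ℝ) {r : ℝ}
    (hr : 0 < r) :
    MemLp (fun ω => (poissonTime (k + 1) N ω - b) / a) (ENNReal.ofReal r) P := by
  simp only [div_eq_inv_mul]
  exact ((hN.memLp_poissonTime k hr).sub (memLp_const b)).const_mul a⁻¹

lemma AreIIDUnitPoisson.integrable_scaled (hN : AreIIDUnitPoisson N P) (k : ℕ) (b a : ℝ) {r : ℝ}
    (hr : 0 < r) :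
    Integrable (fun ω => |(poissonTime (k + 1) N ω - b) / a| ^ r) P := by
  have h := (hN.memLp_scaled k b a hr).integrable_norm_rpow (by simpa using hr)
    ENNReal.ofReal_ne_top
  simpa only [ENNReal.toReal_ofReal hr.le, Real.norm_eq_abs] using h

end PoissonTime

/-! ### Occupancy counts of uniform draws -/

/-- The number of occurrences of each type among the first `k` draws. -/
def drawCount {Ω : Type*} {n : ℕ} (U : ℕ → Ω → Fin n) (k : ℕ) (ω : Ω) (i : Fin n) : ℕ :=
  ((Finset.range k).filter fun j => U j ω = i).card

lemma drawCount_zero {Ω : Type*} {n : ℕ} (U : ℕ → Ω → Fin n) (ω : Ω) : drawCount U 0 ω = 0 := by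
  ext i; simp [drawCount]

lemma drawCount_succ {Ω : Type*} {n : ℕ} (U : ℕ → Ω → Fin n) (k : ℕ) (ω : Ω) (i : Fin n) :
    drawCount U (k + 1) ω i = drawCount U k ω i + if U k ω = i then 1 else 0 := by
  simp only [drawCount, Finset.card_filter, Finset.sum_range_succ]

lemma drawCount_mono {Ω : Type*} {n : ℕ} (U : ℕ → Ω → Fin n) (ω : Ω) (i : Fin n) :
    Monotone fun k => drawCount U k ω i :=
  monotone_nat_of_le_succ fun k => by rw [drawCount_succ]; exact Nat.le_add_right _ _

lemma drawCount_succ_eq_iff {Ω : Type*} {n : ℕ} (U : ℕ → Ω → Fin n) (k : ℕ) (ω : Ω)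
    (v : Fin n → ℕ) {a : ℕ} (hv : v (U k ω) = a + 1) :
    drawCount U (k + 1) ω = v ↔ drawCount U k ω = Function.update v (U k ω) a := by
  simp only [funext_iff, drawCount_succ]
  refine forall_congr' fun i => ?_
  by_cases h : U k ω = i
  · subst h
    simp [hv]
  · rw [Function.update_of_ne (Ne.symm h)]
    simp [h]

lemma drawCount_eq_comp {Ω : Type*} {n : ℕ} (U : ℕ → Ω → Fin n) (k : ℕ) :
    drawCount U k = (fun (u : Finset.range k → Fin n) (i : Fin n) =>
      (Finset.univ.filter fun j => u j = i).card) ∘ fun ω (j : Finset.range k) => U j ω := by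
  ext ω i
  simp only [drawCount, Function.comp_apply, Finset.card_filter]
  exact (Finset.sum_coe_sort (Finset.range k) (fun j => if U j ω = i then 1 else 0)).symm

section Draws

variable {Ω : Type*} [MeasurableSpace Ω] {P : Measure Ω} {n : ℕ} {U : ℕ → Ω → Fin n}

lemma IsUniformDraws.measurable_drawCount (hU : IsUniformDraws U P) (k : ℕ) :
    Measurable (drawCount U k) := by
  rw [drawCount_eq_comp]
  exact Measurable.comp .of_discrete (measurable_pi_lambda _ fun j => hU.measurable j)

lemma IsUniformDraws.indepFun_drawCount (hU : IsUniformDraws U P) (k : ℕ) :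
    IndepFun (drawCount U k) (U k) P := by
  have h := hU.indep.indepFun_finset (Finset.range k) {k} (by simp) hU.measurable
  rw [drawCount_eq_comp]
  have hψ : Measurable fun u : (({k} : Finset ℕ) → Fin n) =>
      u ⟨k, Finset.mem_singleton_self k⟩ := .of_discrete
  exact h.comp .of_discrete hψ

lemma IsUniformDraws.measureReal_drawCount_inter (hU : IsUniformDraws U P) (k : ℕ)
    (v : Fin n → ℕ) (i : Fin n) :
    P.real ({ω | drawCount U k ω = v} ∩ {ω | U k ω = i}) =
      P.real {ω | drawCount U k ω = v} * (n : ℝ)⁻¹ := by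
  have h := (hU.indepFun_drawCount k).measure_inter_preimage_eq_mul {v} {i}
    (.of_discrete) (.of_discrete)
  have hu : P.real {ω | U k ω = i} = (n : ℝ)⁻¹ := by
    simp [measureReal_def, hU.uniform k i]
  rw [← hu, measureReal_def, measureReal_def, measureReal_def, ← ENNReal.toReal_mul]
  exact congrArg ENNReal.toReal h

variable [IsProbabilityMeasure P]

/-- The occupancy counts of uniform draws follow the symmetric multinomial law. -/
lemma IsUniformDraws.measureReal_drawCount (hU : IsUniformDraws U P) (hn : 0 < n) (k : ℕ)
    (v : Fin n → ℕ) :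
    P.real {ω | drawCount U k ω = v} * ((n : ℝ) ^ k * ∏ i, ((v i).factorial : ℝ)) =
      if ∑ i, v i = k then (k.factorial : ℝ) else 0 := by
  have hn0 : (n : ℝ) ≠ 0 := by positivity
  induction k generalizing v with
  | zero =>
    simp only [drawCount_zero, Finset.sum_eq_zero_iff, Finset.mem_univ, true_implies, pow_zero,
      one_mul, Nat.factorial_zero, Nat.cast_one]
    by_cases h : v = 0
    · subst h
      simp
    · have h' : ¬ ∀ i, v i = 0 := fun h' => h (funext h')
      rw [if_neg h']
      have : {ω : Ω | (0 : Fin n → ℕ) = v} = ∅ := by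
        ext; simp [Ne.symm h]
      rw [this]
      simp
  | succ k ih =>
    -- Condition on the last draw: given type `i`, the earlier counts are `v` with one `i` removed.
    -- The ratio of the factorial products contributes the factor `v i`, and summing over `i` gives
    -- `k + 1`.
    have key : ∀ i, P.real ({ω | drawCount U (k + 1) ω = v} ∩ {ω | U k ω = i}) *
        ((n : ℝ) ^ (k + 1) * ∏ i, ((v i).factorial : ℝ)) =
        v i * if ∑ i, v i = k + 1 then (k.factorial : ℝ) else 0 := by
      intro i
      rcases hvi : v i with _ | a
      · have : {ω | drawCount U (k + 1) ω = v} ∩ {ω | U k ω = i} = ∅ := by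
          ext ω
          simp only [Set.mem_inter_iff, Set.mem_ofPred_eq, Set.mem_empty_iff_false, iff_false,
            not_and]
          rintro rfl hi
          rw [drawCount_succ, if_pos hi] at hvi
          omega
        rw [this]
        simp
      · have hset : {ω | drawCount U (k + 1) ω = v} ∩ {ω | U k ω = i} =
            {ω | drawCount U k ω = Function.update v i a} ∩ {ω | U k ω = i} := by
          ext ω
          simp only [Set.mem_inter_iff, Set.mem_ofPred_eq, and_congr_left_iff]
          rintro rfl
          exact drawCount_succ_eq_iff U k ω v hvi
        have hprod : ∏ j, ((v j).factorial : ℝ) =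
            (a + 1) * ∏ j, ((Function.update v i a j).factorial : ℝ) := by
          rw [← Finset.mul_prod_erase _ _ (Finset.mem_univ i),
            ← Finset.mul_prod_erase _ (fun j => ((Function.update v i a j).factorial : ℝ))
              (Finset.mem_univ i), hvi, Function.update_self, Nat.factorial_succ]
          have : ∏ j ∈ Finset.univ.erase i, ((Function.update v i a j).factorial : ℝ) =
              ∏ j ∈ Finset.univ.erase i, ((v j).factorial : ℝ) :=
            Finset.prod_congr rfl fun j hj => by
              rw [Function.update_of_ne (Finset.ne_of_mem_erase hj)]
          rw [this]
          push_cast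
          ring
        have hsum : ∑ j, v j = ∑ j, Function.update v i a j + 1 := by
          rw [← Finset.add_sum_erase _ _ (Finset.mem_univ i),
            ← Finset.add_sum_erase _ (Function.update v i a) (Finset.mem_univ i), hvi,
            Function.update_self]
          have : ∑ j ∈ Finset.univ.erase i, Function.update v i a j =
              ∑ j ∈ Finset.univ.erase i, v j :=
            Finset.sum_congr rfl fun j hj => by
              rw [Function.update_of_ne (Finset.ne_of_mem_erase hj)]
          rw [this]
          ring
        rw [hset, hU.measureReal_drawCount_inter, hprod, hsum]
        simp only [add_left_inj]
        rw [← ih (Function.update v i a)]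
        push_cast
        field_simp
        ring
    have hunion : {ω | drawCount U (k + 1) ω = v} =
        ⋃ i ∈ (Finset.univ : Finset (Fin n)),
          ({ω | drawCount U (k + 1) ω = v} ∩ {ω | U k ω = i}) := by
      ext ω; simp
    rw [hunion, measureReal_biUnion_finset, Finset.sum_mul, Finset.sum_congr rfl fun i _ => key i,
      ← Finset.sum_mul]
    · split_ifs with h
      · rw [← Nat.cast_sum, h, Nat.factorial_succ]
        push_cast
        ring
      · rw [mul_zero]
    · intro i _ j _ hij
      refine Set.disjoint_left.2 fun ω hi hj => hij ?_
      rw [← hi.2, ← hj.2]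
    · intro i _
      exact ((hU.measurable_drawCount (k + 1)) (.of_discrete (s := {v}))).inter
        (hU.measurable k (.of_discrete (s := {i})))

/-- Poissonization: occupancy counts after a Poisson number of draws are independent Poisson. -/
lemma IsUniformDraws.pi_poissonMeasure_eq_tsum (hU : IsUniformDraws U P) (hn : 0 < n) (t : ℝ≥0)
    (A : Set (Fin n → ℕ)) :
    Measure.pi (fun _ : Fin n => poissonMeasure t) A =
      ∑' k, poissonMeasure (n * t) {k} * P {ω | drawCount U k ω ∈ A} := by
  have h : Measure.pi (fun _ : Fin n => poissonMeasure t) =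
      Measure.sum fun k => poissonMeasure (n * t) {k} • P.map (drawCount U k) := by
    refine Measure.ext_of_singleton fun v => ?_
    rw [Measure.sum_apply _ .of_discrete, Measure.pi_singleton]
    have hterm : ∀ k, (poissonMeasure (n * t) {k} • P.map (drawCount U k)) {v} =
        poissonMeasure (n * t) {k} * ENNReal.ofReal (P.real {ω | drawCount U k ω = v}) := by
      intro k
      rw [Measure.smul_apply, Measure.map_apply (hU.measurable_drawCount k) .of_discrete,
        smul_eq_mul, ofReal_measureReal]
      rfl
    have hne : (∏ i, ((v i).factorial : ℝ)) ≠ 0 :=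
      Finset.prod_ne_zero_iff.2 fun i _ => by positivity
    have hn0 : (n : ℝ) ≠ 0 := by positivity
    simp only [hterm]
    -- The counts add up to the number of draws, so only `k = ∑ i, v i` contributes to the mass at
    -- `v`.
    rw [tsum_eq_single (∑ i, v i)]
    · have h1 := hU.measureReal_drawCount hn (∑ i, v i) v
      rw [if_pos rfl, ← eq_div_iff (by positivity)] at h1
      simp only [poissonMeasure_singleton]
      rw [h1, ← ENNReal.ofReal_prod_of_nonneg fun i _ => by positivity,
        ← ENNReal.ofReal_mul (by positivity)]
      congr 1
      rw [Finset.prod_div_distrib, Finset.prod_mul_distrib, Finset.prod_const, Finset.card_univ,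
        Fintype.card_fin, ← Real.exp_nat_mul, Finset.prod_pow_eq_pow_sum]
      push_cast
      have : ((∑ i, v i).factorial : ℝ) ≠ 0 := by positivity
      rw [mul_pow, mul_neg]
      field_simp
    · intro k hk
      have h1 := hU.measureReal_drawCount hn k v
      rw [if_neg (Ne.symm hk)] at h1
      have h2 : P.real {ω | drawCount U k ω = v} = 0 := by
        rcases mul_eq_zero.1 h1 with h | h
        · exact h
        · exact absurd h (by positivity)
      rw [h2, ENNReal.ofReal_zero, mul_zero]
  rw [h, Measure.sum_apply _ .of_discrete]
  refine tsum_congr fun k => ?_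
  rw [Measure.smul_apply, Measure.map_apply (hU.measurable_drawCount k) .of_discrete, smul_eq_mul]
  rfl

end Draws

/-! ### The number of draws and its moments -/

/-- The event that after `k` draws some type has occurred fewer than `m` times. -/
def incomplete {Ω : Type*} {n : ℕ} (m : ℕ) (U : ℕ → Ω → Fin n) (k : ℕ) : Set Ω :=
  {ω | ¬ ∀ i, m ≤ drawCount U k ω i}

/-- Completeness at some `k` is required: otherwise the infimum is that of the empty set, namely
zero. -/
lemma lt_couponTime_iff {Ω : Type*} {n : ℕ} {m : ℕ} {U : ℕ → Ω → Fin n} {ω : Ω}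
    (h : ∃ k, ∀ i, m ≤ drawCount U k ω i) (k : ℕ) :
    k < couponTime m U ω ↔ ω ∈ incomplete m U k := by
  have hdef : couponTime m U ω = sInf {k | ∀ i, m ≤ drawCount U k ω i} := rfl
  have hmem : ∀ i, m ≤ drawCount U (sInf {k | ∀ i, m ≤ drawCount U k ω i}) ω i := Nat.sInf_mem h
  rw [← not_le, hdef]
  refine not_congr ⟨fun hle i => (hmem i).trans (drawCount_mono U ω i hle), fun hk => Nat.sInf_le hk⟩

lemma setLIntegral_poissonMeasure_singleton {n : ℕ} (hn : 0 < n) (k : ℕ) {r : ℝ} (hr : 0 < r) :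
    ∫⁻ t in Set.Ioi (0 : ℝ), poissonMeasure (n * t.toNNReal) {k} * ENNReal.ofReal (t ^ (r - 1)) =
      ENNReal.ofReal ((1 / n) ^ r * (Real.Gamma (k + r) / k.factorial)) := by
  have hn0 : (0 : ℝ) < n := by exact_mod_cast hn
  have hf : (0 : ℝ) < k.factorial := by positivity
  have ha : 0 < k + r := by positivity
  have hI := Real.integral_rpow_mul_exp_neg_mul_Ioi ha hn0
  have hint : IntegrableOn (fun t : ℝ => t ^ (k + r - 1) * Real.exp (-(n * t))) (Set.Ioi 0) := by
    have := integrableOn_rpow_mul_exp_neg_mul_rpow (p := 1) (s := k + r - 1) (b := n)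
      (by linarith) one_pos hn0
    simpa only [Real.rpow_one, neg_mul] using this
  have hcongr : ∫⁻ t in Set.Ioi (0 : ℝ),
      poissonMeasure (n * t.toNNReal) {k} * ENNReal.ofReal (t ^ (r - 1)) =
      ∫⁻ t in Set.Ioi (0 : ℝ), ENNReal.ofReal ((n : ℝ) ^ k / k.factorial *
        (t ^ (k + r - 1) * Real.exp (-(n * t)))) := by
    refine setLIntegral_congr_fun measurableSet_Ioi fun t ht => ?_
    have ht' : (0 : ℝ) < t := ht
    rw [poissonMeasure_singleton, ← ENNReal.ofReal_mul (by positivity)]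
    congr 1
    rw [NNReal.coe_mul, NNReal.coe_natCast, Real.coe_toNNReal t ht'.le,
      show (k : ℝ) + r - 1 = (k : ℝ) + (r - 1) by ring, Real.rpow_add ht', Real.rpow_natCast]
    ring
  rw [hcongr, ← ofReal_integral_eq_lintegral_ofReal (hint.const_mul _)
    ((ae_restrict_iff' measurableSet_Ioi).2 (ae_of_all _ fun t ht => by
      have : (0 : ℝ) < t := ht
      positivity)), integral_const_mul, hI]
  congr 1
  rw [Real.rpow_add (by positivity), Real.rpow_natCast, one_div, inv_pow]
  field_simp

section

variable {Ω : Type*} [MeasurableSpace Ω] {P : Measure Ω} {n : ℕ} {U : ℕ → Ω → Fin n}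

lemma IsUniformDraws.measurableSet_incomplete (hU : IsUniformDraws U P) (m k : ℕ) :
    MeasurableSet (incomplete m U k) :=
  hU.measurable_drawCount k (.of_discrete (s := {v : Fin n → ℕ | ¬ ∀ i, m ≤ v i}))

variable [IsProbabilityMeasure P]

/-- The Poissonization identity between the two completion problems. -/
lemma IsUniformDraws.tsum_incomplete (hU : IsUniformDraws U P) (hn : 0 < n) (m : ℕ) (t : ℝ≥0) :
    ∑' k, poissonMeasure (n * t) {k} * P (incomplete (m + 1) U k) =
      ENNReal.ofReal (1 - (1 - gammaTail (m + 1) t) ^ n) := by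
  have hF : 0 ≤ 1 - gammaTail (m + 1) t := by linarith [gammaTail_le_one m t.coe_nonneg]
  have h := hU.pi_poissonMeasure_eq_tsum hn t {v | ¬ ∀ i, m + 1 ≤ v i}
  refine h.symm.trans ?_
  have e : {v : Fin n → ℕ | ¬ ∀ i, m + 1 ≤ v i} = (Set.univ.pi fun _ => {j | m + 1 ≤ j})ᶜ := by
    ext v; simp
  rw [e, prob_compl_eq_one_sub .of_discrete, Measure.pi_pi]
  simp only [poissonMeasure_setOf_le, Finset.prod_const, Finset.card_univ, Fintype.card_fin]
  rw [← ENNReal.ofReal_pow hF, ← ENNReal.ofReal_one, ← ENNReal.ofReal_sub _ (by positivity)]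

/-- Never completing is contained in every incompleteness event, so averaging over a Poisson number
of draws bounds its probability by `n Q(t)`, which tends to zero. -/
lemma IsUniformDraws.ae_exists_complete (hU : IsUniformDraws U P) (hn : 0 < n) (m : ℕ) :
    ∀ᵐ ω ∂P, ∃ k, ∀ i, m + 1 ≤ drawCount U k ω i := by
  rw [ae_iff]
  have hle : ∀ t : ℕ, P {ω | ¬ ∃ k, ∀ i, m + 1 ≤ drawCount U k ω i} ≤
      ENNReal.ofReal (n * 2 ^ (m + 1) * Real.exp (-((t : ℝ) / 2))) := by
    intro t
    calc P {ω | ¬ ∃ k, ∀ i, m + 1 ≤ drawCount U k ω i}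
        = ∑' k, poissonMeasure (n * (t : ℝ≥0)) {k} *
            P {ω | ¬ ∃ k, ∀ i, m + 1 ≤ drawCount U k ω i} := by
          rw [ENNReal.tsum_mul_right]
          have := hU.pi_poissonMeasure_eq_tsum hn t Set.univ
          simp only [measure_univ, Set.mem_univ, Set.ofPred_true, mul_one] at this
          rw [← this, one_mul]
      _ ≤ ∑' k, poissonMeasure (n * (t : ℝ≥0)) {k} * P (incomplete (m + 1) U k) := by
          exact ENNReal.tsum_le_tsum fun k => mul_le_mul_of_nonneg_left
            (measure_mono fun ω hω hk => hω ⟨k, hk⟩) zero_le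
      _ ≤ _ := by
          rw [hU.tsum_incomplete hn]
          refine ENNReal.ofReal_le_ofReal ?_
          have ht : (0 : ℝ) ≤ ((t : ℝ≥0) : ℝ) := NNReal.coe_nonneg _
          refine (one_sub_pow_le_mul_gammaTail n m ht).trans ?_
          rw [mul_assoc]
          gcongr
          exact gammaTail_le_two_pow_mul_exp (m + 1) ht
  have hlim := ENNReal.tendsto_ofReal (tendsto_exp_neg_half_nat (n * 2 ^ (m + 1)))
  rw [ENNReal.ofReal_zero] at hlim
  exact le_antisymm (ge_of_tendsto' hlim hle) zero_le

lemma IsUniformDraws.ae_lt_couponTime_iff (hU : IsUniformDraws U P) (hn : 0 < n) (m : ℕ) :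
    ∀ᵐ ω ∂P, ∀ k, k < couponTime (m + 1) U ω ↔ ω ∈ incomplete (m + 1) U k := by
  filter_upwards [hU.ae_exists_complete hn m] with ω hω k using lt_couponTime_iff hω k

lemma IsUniformDraws.aemeasurable_couponTime (hU : IsUniformDraws U P) (hn : 0 < n) (m : ℕ) :
    AEMeasurable (couponTime (m + 1) U) P := by
  have h : NullMeasurable (couponTime (m + 1) U) P := by
    refine measurable_of_Ioi (δ := NullMeasurableSpace Ω P) fun k => ?_
    change NullMeasurableSet {ω | k < couponTime (m + 1) U ω} P
    refine (hU.measurableSet_incomplete (m + 1) k).nullMeasurableSet.congr ?_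
    filter_upwards [hU.ae_lt_couponTime_iff hn m] with ω hω
    exact propext (hω k).symm
  exact h.aemeasurable

lemma IsUniformDraws.aemeasurable_couponTime_cast (hU : IsUniformDraws U P) (hn : 0 < n) (m : ℕ) :
    AEMeasurable (fun ω => (couponTime (m + 1) U ω : ℝ)) P :=
  measurable_from_nat.comp_aemeasurable (hU.aemeasurable_couponTime hn m)

/-- Discrete layer-cake formula. The weights `g = 1` and `g j = 2(j+1)` produce `T` and `T(T+1)`,
the quantities matching the first two moments of `τ`. -/
lemma IsUniformDraws.lintegral_sum_couponTime (hU : IsUniformDraws U P) (hn : 0 < n) (m : ℕ)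
    (g : ℕ → ℝ≥0∞) :
    ∫⁻ ω, ∑ j ∈ Finset.range (couponTime (m + 1) U ω), g j ∂P =
      ∑' j, g j * P (incomplete (m + 1) U j) := by
  calc ∫⁻ ω, ∑ j ∈ Finset.range (couponTime (m + 1) U ω), g j ∂P
      = ∫⁻ ω, ∑' j, (incomplete (m + 1) U j).indicator (fun _ => g j) ω ∂P := by
        refine lintegral_congr_ae ?_
        filter_upwards [hU.ae_lt_couponTime_iff hn m] with ω hω
        rw [tsum_eq_sum (s := Finset.range (couponTime (m + 1) U ω))]
        · refine Finset.sum_congr rfl fun j hj => ?_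
          rw [Set.indicator_of_mem ((hω j).1 (Finset.mem_range.1 hj))]
        · intro j hj
          rw [Set.indicator_of_notMem fun h => hj (Finset.mem_range.2 ((hω j).2 h))]
    _ = ∑' j, ∫⁻ ω, (incomplete (m + 1) U j).indicator (fun _ => g j) ω ∂P :=
        lintegral_tsum fun j =>
          (measurable_const.indicator (hU.measurableSet_incomplete (m + 1) j)).aemeasurable
    _ = _ := by
        refine tsum_congr fun j => ?_
        rw [lintegral_indicator_const (hU.measurableSet_incomplete (m + 1) j)]

/-! ### Exact moment identities between the draws and the Poissonized time. -/

variable {Ω' : Type*} [MeasurableSpace Ω'] {P' : Measure Ω'} [IsProbabilityMeasure P']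
  {N : Fin n → ℝ≥0 → Ω' → ℕ}

/-- Moments of the Poissonized completion time as series in the tail of the number of draws. -/
lemma IsUniformDraws.lintegral_poissonTime_rpow (hU : IsUniformDraws U P)
    (hN : AreIIDUnitPoisson N P') (hn : 0 < n) (m : ℕ) {r : ℝ} (hr : 0 < r) :
    ∫⁻ ω, ENNReal.ofReal (poissonTime (m + 1) N ω ^ r) ∂P' =
      ENNReal.ofReal r * ∑' k : ℕ, ENNReal.ofReal ((1 / n) ^ r * (Real.Gamma (k + r) / k.factorial)) *
        P (incomplete (m + 1) U k) := by
  rw [lintegral_rpow_eq_lintegral_meas_lt_mul P' (ae_of_all _ (poissonTime_nonneg _ _))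
    (hN.aemeasurable_poissonTime _) hr]
  congr 1
  calc ∫⁻ t in Set.Ioi 0, P' {ω | t < poissonTime (m + 1) N ω} * ENNReal.ofReal (t ^ (r - 1))
      = ∫⁻ t in Set.Ioi (0 : ℝ), ∑' k, P (incomplete (m + 1) U k) *
          (poissonMeasure (n * t.toNNReal) {k} * ENNReal.ofReal (t ^ (r - 1))) := by
        refine setLIntegral_congr_fun measurableSet_Ioi fun t ht => ?_
        have ht' : (0 : ℝ) ≤ t := le_of_lt ht
        rw [hN.measure_lt_poissonTime m ht']
        have h := hU.tsum_incomplete hn m t.toNNReal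
        rw [Real.coe_toNNReal t ht'] at h
        rw [← h, ← ENNReal.tsum_mul_right]
        refine tsum_congr fun k => ?_
        ring
    _ = ∑' k, ∫⁻ t in Set.Ioi (0 : ℝ), P (incomplete (m + 1) U k) *
          (poissonMeasure (n * t.toNNReal) {k} * ENNReal.ofReal (t ^ (r - 1))) := by
        refine lintegral_tsum fun k => ?_
        simp only [poissonMeasure_singleton]
        fun_prop
    _ = _ := by
        refine tsum_congr fun k => ?_
        rw [lintegral_const_mul', setLIntegral_poissonMeasure_singleton hn k hr, mul_comm]
        exact measure_ne_top _ _

lemma IsUniformDraws.lintegral_couponTime (hU : IsUniformDraws U P)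
    (hN : AreIIDUnitPoisson N P') (hn : 0 < n) (m : ℕ) :
    ∫⁻ ω, ENNReal.ofReal (couponTime (m + 1) U ω) ∂P =
      ENNReal.ofReal n * ∫⁻ ω, ENNReal.ofReal (poissonTime (m + 1) N ω) ∂P' := by
  have hn0 : (n : ℝ) ≠ 0 := by positivity
  have h1 := hU.lintegral_sum_couponTime hn m fun _ => 1
  have h2 := hU.lintegral_poissonTime_rpow hN hn m one_pos
  simp only [Finset.sum_const, Finset.card_range, nsmul_eq_mul, mul_one, one_mul] at h1
  simp only [Real.rpow_one, Real.Gamma_nat_eq_factorial, ENNReal.ofReal_one, one_mul] at h2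
  simp only [ENNReal.ofReal_natCast]
  rw [h1, h2, ← ENNReal.tsum_mul_left]
  refine tsum_congr fun k => ?_
  rw [← mul_assoc, ← ENNReal.ofReal_natCast n, ← ENNReal.ofReal_mul (by positivity)]
  have : (k.factorial : ℝ) ≠ 0 := by positivity
  rw [show (n : ℝ) * (1 / n * (k.factorial / k.factorial)) = 1 by field_simp, ENNReal.ofReal_one,
    one_mul]

lemma IsUniformDraws.lintegral_couponTime_mul_succ (hU : IsUniformDraws U P)
    (hN : AreIIDUnitPoisson N P') (hn : 0 < n) (m : ℕ) :
    ∫⁻ ω, ENNReal.ofReal (couponTime (m + 1) U ω * (couponTime (m + 1) U ω + 1)) ∂P =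
      ENNReal.ofReal (n ^ 2) * ∫⁻ ω, ENNReal.ofReal (poissonTime (m + 1) N ω ^ 2) ∂P' := by
  have hn0 : (n : ℝ) ≠ 0 := by positivity
  have h1 := hU.lintegral_sum_couponTime hn m fun j => ENNReal.ofReal (2 * (j + 1))
  have h2 := hU.lintegral_poissonTime_rpow hN hn m two_pos
  have hsum : ∀ T : ℕ, ∑ j ∈ Finset.range T, ENNReal.ofReal (2 * ((j : ℝ) + 1)) =
      ENNReal.ofReal (T * (T + 1)) := by
    intro T
    rw [← ENNReal.ofReal_sum_of_nonneg fun j _ => by positivity]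
    congr 1
    induction T with
    | zero => simp
    | succ T ih => rw [Finset.sum_range_succ, ih]; push_cast; ring
  simp only [hsum] at h1
  simp only [Real.rpow_two] at h2
  rw [h1, h2, ← ENNReal.tsum_mul_left, ← ENNReal.tsum_mul_left]
  refine tsum_congr fun k => ?_
  rw [← mul_assoc, ← mul_assoc, ← ENNReal.ofReal_mul (by positivity),
    ← ENNReal.ofReal_mul (by positivity)]
  congr 2
  have : (k.factorial : ℝ) ≠ 0 := by positivity
  -- For `r = 2` the weight `2 Γ(k+2)/k!` is `2(k+1)`, so the rising factorial `T(T+1)` appears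
  -- rather than `T²`.
  have hG : Real.Gamma ((k : ℝ) + 2) = (k + 1) * k.factorial := by
    have := Real.Gamma_nat_eq_factorial (k + 1)
    rw [Nat.factorial_succ] at this
    push_cast at this
    rw [← this]
    ring_nf
  rw [hG]
  field_simp

lemma IsUniformDraws.integral_couponTime (hU : IsUniformDraws U P)
    (hN : AreIIDUnitPoisson N P') (hn : 0 < n) (m : ℕ) :
    ∫ ω, (couponTime (m + 1) U ω : ℝ) ∂P = n * ∫ ω, poissonTime (m + 1) N ω ∂P' := by
  rw [integral_eq_lintegral_of_nonneg_ae (ae_of_all _ fun ω => Nat.cast_nonneg _)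
      (hU.aemeasurable_couponTime_cast hn m).aestronglyMeasurable,
    integral_eq_lintegral_of_nonneg_ae (ae_of_all _ (poissonTime_nonneg _ _))
      (hN.aemeasurable_poissonTime _).aestronglyMeasurable,
    hU.lintegral_couponTime hN hn m, ENNReal.toReal_mul, ENNReal.toReal_ofReal (by positivity)]

lemma AreIIDUnitPoisson.memLp_two_poissonTime (hN : AreIIDUnitPoisson N P') (m : ℕ) :
    MemLp (poissonTime (m + 1) N) 2 P' := by
  simpa using hN.memLp_poissonTime m two_pos

lemma IsUniformDraws.integrable_couponTime_mul_succ (hU : IsUniformDraws U P)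
    (hN : AreIIDUnitPoisson N P') (hn : 0 < n) (m : ℕ) :
    Integrable (fun ω => (couponTime (m + 1) U ω : ℝ) * (couponTime (m + 1) U ω + 1)) P := by
  have hm := hU.aemeasurable_couponTime_cast hn m
  refine ⟨(hm.mul (hm.add_const 1)).aestronglyMeasurable, ?_⟩
  rw [hasFiniteIntegral_iff_ofReal (ae_of_all _ fun ω => by positivity),
    hU.lintegral_couponTime_mul_succ hN hn m]
  exact ENNReal.mul_lt_top ENNReal.ofReal_lt_top
    (hN.memLp_two_poissonTime m).integrable_sq.lintegral_lt_top

lemma IsUniformDraws.memLp_couponTime (hU : IsUniformDraws U P)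
    (hN : AreIIDUnitPoisson N P') (hn : 0 < n) (m : ℕ) :
    MemLp (fun ω => (couponTime (m + 1) U ω : ℝ)) 2 P := by
  have hm := hU.aemeasurable_couponTime_cast hn m
  rw [memLp_two_iff_integrable_sq hm.aestronglyMeasurable]
  refine (hU.integrable_couponTime_mul_succ hN hn m).mono' (hm.pow_const 2).aestronglyMeasurable
    (ae_of_all _ fun ω => ?_)
  rw [Real.norm_of_nonneg (by positivity)]
  nlinarith [(Nat.cast_nonneg (couponTime (m + 1) U ω) : (0 : ℝ) ≤ _)]

/-- De-Poissonization of the variance. -/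
lemma IsUniformDraws.variance_couponTime (hU : IsUniformDraws U P)
    (hN : AreIIDUnitPoisson N P') (hn : 0 < n) (m : ℕ) :
    variance (fun ω => (couponTime (m + 1) U ω : ℝ)) P =
      n ^ 2 * variance (poissonTime (m + 1) N) P' - n * ∫ ω, poissonTime (m + 1) N ω ∂P' := by
  have hT := hU.memLp_couponTime hN hn m
  have hτ := hN.memLp_two_poissonTime m
  have hsq : ∫ ω, (couponTime (m + 1) U ω : ℝ) * (couponTime (m + 1) U ω + 1) ∂P =
      n ^ 2 * ∫ ω, poissonTime (m + 1) N ω ^ 2 ∂P' := by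
    rw [integral_eq_lintegral_of_nonneg_ae (ae_of_all _ fun ω => by positivity)
      (hU.integrable_couponTime_mul_succ hN hn m).aestronglyMeasurable,
      integral_eq_lintegral_of_nonneg_ae (ae_of_all _ fun ω => sq_nonneg _)
      hτ.integrable_sq.aestronglyMeasurable,
      hU.lintegral_couponTime_mul_succ hN hn m, ENNReal.toReal_mul,
      ENNReal.toReal_ofReal (by positivity)]
  have hadd : ∫ ω, (couponTime (m + 1) U ω : ℝ) * (couponTime (m + 1) U ω + 1) ∂P =
      ∫ ω, (couponTime (m + 1) U ω : ℝ) ^ 2 ∂P + ∫ ω, (couponTime (m + 1) U ω : ℝ) ∂P := by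
    rw [← integral_add hT.integrable_sq (hT.integrable one_le_two)]
    refine integral_congr_ae (ae_of_all _ fun ω => ?_)
    ring
  have hmean := hU.integral_couponTime hN hn m
  rw [variance_eq_sub hT, variance_eq_sub hτ]
  simp only [Pi.pow_apply]
  rw [hmean]
  rw [hmean, hsq] at hadd
  linarith

end

/-! ### Gumbel limit of the scaled completion time -/

lemma one_le_millsRatio (k : ℕ) {x : ℝ} (hx : 0 < x) : 1 ≤ millsRatio (k + 1) x := by
  rw [millsRatio, one_le_div (gammaDens_pos k hx), gammaTail_succ]
  have : 0 ≤ gammaTail k x := by unfold gammaTail; positivity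
  linarith

/-- The bounds `-q/(1-q) ≤ log (1-q) ≤ -q` squeeze `N log (1-q)` as `q → 0`. -/
lemma tendsto_one_sub_pow_exp {ι : Type*} {l : Filter ι} {N : ι → ℕ} {q : ι → ℝ} {L : ℝ}
    (hN : Tendsto (fun i => (N i : ℝ)) l atTop) (hq : Tendsto (fun i => N i * q i) l (𝓝 L)) :
    Tendsto (fun i => (1 - q i) ^ N i) l (𝓝 (Real.exp (-L))) := by
  have hq0 : Tendsto q l (𝓝 0) := by
    refine (hq.div_atTop hN).congr' ?_
    filter_upwards [hN.eventually_gt_atTop 0] with i hi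
    field_simp
  have h1 : Tendsto (fun i => 1 - q i) l (𝓝 1) := by simpa using hq0.const_sub 1
  have hpos : ∀ᶠ i in l, 0 < 1 - q i := h1.eventually_const_lt one_pos
  have hlog : Tendsto (fun i => N i * Real.log (1 - q i)) l (𝓝 (-L)) := by
    have hlow : Tendsto (fun i => -(N i * q i) / (1 - q i)) l (𝓝 (-L)) := by
      exact (hq.neg.div h1 one_ne_zero).mono_right (by rw [div_one])
    refine tendsto_of_tendsto_of_tendsto_of_le_of_le' hlow hq.neg ?_ ?_
    · filter_upwards [hpos] with i hi
      have h2 := Real.one_sub_inv_le_log_of_pos hi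
      calc -(N i * q i) / (1 - q i) = N i * (1 - (1 - q i)⁻¹) := by field_simp; ring
        _ ≤ _ := by gcongr
    · filter_upwards [hpos] with i hi
      have h2 := Real.log_le_sub_one_of_pos hi
      calc (N i : ℝ) * Real.log (1 - q i) ≤ N i * (1 - q i - 1) := by gcongr
        _ = _ := by ring
  refine ((Real.continuous_exp.tendsto _).comp hlog).congr' ?_
  filter_upwards [hpos] with i hi
  rw [Function.comp_apply, Real.exp_nat_mul, Real.exp_log hi]

section ScaledLaw

variable {Ω : Type*} [MeasurableSpace Ω] {P : Measure Ω}
  {n : ℕ} {N : Fin n → ℝ≥0 → Ω → ℕ}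

lemma AreIIDUnitPoisson.aemeasurable_scaled (hN : AreIIDUnitPoisson N P) (k : ℕ) (b a : ℝ) :
    AEMeasurable (fun ω => (poissonTime (k + 1) N ω - b) / a) P :=
  ((hN.aemeasurable_poissonTime (k + 1)).sub_const b).div_const a

lemma AreIIDUnitPoisson.map_scaled_Iic (hN : AreIIDUnitPoisson N P) (k : ℕ) (b : ℝ) {a : ℝ}
    (ha : 0 < a) (x : ℝ) :
    P.map (fun ω => (poissonTime (k + 1) N ω - b) / a) (Set.Iic x) =
      P {ω | poissonTime (k + 1) N ω ≤ b + a * x} := by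
  rw [Measure.map_apply_of_aemeasurable (hN.aemeasurable_scaled k b a) measurableSet_Iic]
  congr 1
  ext ω
  simp only [Set.mem_preimage, Set.mem_Iic, Set.mem_ofPred_eq, div_le_iff₀ ha]
  constructor <;> intro h <;> linarith

lemma AreIIDUnitPoisson.map_scaled_Ioi_le [IsProbabilityMeasure P]
    (hN : AreIIDUnitPoisson N P) (k : ℕ) {b : ℝ}
    (hb : 0 < b) (hQ : n * gammaTail (k + 1) b = 1) {x : ℝ} (hx : 0 ≤ x) :
    P.map (fun ω => (poissonTime (k + 1) N ω - b) / millsRatio (k + 1) b) (Set.Ioi x) ≤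
      ENNReal.ofReal (Real.exp (-x)) := by
  have ha := millsRatio_pos k hb
  have hy : 0 ≤ b + millsRatio (k + 1) b * x := by positivity
  rw [Measure.map_apply_of_aemeasurable (hN.aemeasurable_scaled k b _) measurableSet_Ioi]
  have e : (fun ω => (poissonTime (k + 1) N ω - b) / millsRatio (k + 1) b) ⁻¹' Set.Ioi x =
      {ω | b + millsRatio (k + 1) b * x < poissonTime (k + 1) N ω} := by
    ext ω
    simp only [Set.mem_preimage, Set.mem_Ioi, Set.mem_ofPred_eq, lt_div_iff₀ ha]
    constructor <;> intro h <;> linarith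
  rw [e, hN.measure_lt_poissonTime k hy]
  exact ENNReal.ofReal_le_ofReal ((one_sub_pow_le_mul_gammaTail n k hy).trans
    (mul_gammaTail_add_le_exp k hb hQ hx))

lemma AreIIDUnitPoisson.map_scaled_Iic_le (hN : AreIIDUnitPoisson N P) (hn : 0 < n) (k : ℕ) {b : ℝ}
    (hb : 0 < b) (hQ : n * gammaTail (k + 1) b = 1) {x : ℝ} (hx : 0 ≤ x) :
    P.map (fun ω => (poissonTime (k + 1) N ω - b) / millsRatio (k + 1) b) (Set.Iic (-x)) ≤
      ENNReal.ofReal (Real.exp (-x)) := by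
  have ha := millsRatio_pos k hb
  have e : b + millsRatio (k + 1) b * -x = b - millsRatio (k + 1) b * x := by ring
  rw [hN.map_scaled_Iic k b ha, e]
  rcases lt_trichotomy (b - millsRatio (k + 1) b * x) 0 with h | h | h
  · rw [measure_poissonTime_le_of_neg _ _ h]
    exact zero_le
  -- At the origin the distribution function is `0 ^ n`, which vanishes because `n` is positive.
  · rw [h, hN.measure_poissonTime_le k le_rfl, gammaTail_zero_right, sub_self, zero_pow hn.ne',
      ENNReal.ofReal_zero]
    exact zero_le
  · rw [hN.measure_poissonTime_le k h.le]
    refine ENNReal.ofReal_le_ofReal ((one_sub_gammaTail_pow_le_exp k hb hQ hx h).trans ?_)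
    exact Real.exp_le_exp.2 (by linarith)

end ScaledLaw

section Limit

variable {k : ℕ+ → ℕ} {b : ℕ+ → ℝ} {Ω : ℕ+ → Type*} [∀ n, MeasurableSpace (Ω n)]
  {P : ∀ n, Measure (Ω n)}
  {N : ∀ n : ℕ+, Fin (n : ℕ) → ℝ≥0 → Ω n → ℕ}

lemma tendsto_map_scaled_Iic
    (hb : ∀ᶠ n : ℕ+ in atTop, 0 ≤ b n ∧ (n : ℝ) * gammaTail (k n + 1) (b n) = 1)
    (hN : ∀ n, AreIIDUnitPoisson (N n) (P n)) (x : ℝ) :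
    Tendsto (fun n => (P n).map (fun ω => (poissonTime (k n + 1) (N n) ω - b n) /
      millsRatio (k n + 1) (b n)) (Set.Iic x)) atTop (𝓝 (gumbelMeasure (Set.Iic x))) := by
  rw [gumbelMeasure_Iic]
  refine (ENNReal.tendsto_ofReal (tendsto_one_sub_pow_exp tendsto_pnat_coe_atTop
    (tendsto_mul_gammaTail hb x))).congr' ?_
  filter_upwards [eventually_lt_of_tail hb, (tendsto_millsRatio_mul_div hb x).1] with n hn hpos
  have hb0 := (k n).cast_nonneg.trans_lt hn
  rw [(hN n).map_scaled_Iic (k n) (b n) (millsRatio_pos (k n) hb0),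
    (hN n).measure_poissonTime_le (k n) hpos.le]

variable [∀ n, IsProbabilityMeasure (P n)]

lemma eventually_map_scaled_tails
    (hb : ∀ᶠ n : ℕ+ in atTop, 0 ≤ b n ∧ (n : ℝ) * gammaTail (k n + 1) (b n) = 1)
    (hN : ∀ n, AreIIDUnitPoisson (N n) (P n)) :
    ∀ᶠ n in atTop, ∀ t, 0 ≤ t →
      (P n).map (fun ω => (poissonTime (k n + 1) (N n) ω - b n) / millsRatio (k n + 1) (b n))
        (Set.Ioi t) ≤ ENNReal.ofReal (Real.exp (-t)) ∧
      (P n).map (fun ω => (poissonTime (k n + 1) (N n) ω - b n) / millsRatio (k n + 1) (b n))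
        (Set.Iic (-t)) ≤ ENNReal.ofReal (Real.exp (-t)) := by
  filter_upwards [hb, eventually_lt_of_tail hb] with n hn hlt t ht
  have hb0 := (k n).cast_nonneg.trans_lt hlt
  exact ⟨(hN n).map_scaled_Ioi_le (k n) hb0 hn.2 ht,
    (hN n).map_scaled_Iic_le n.pos (k n) hb0 hn.2 ht⟩

lemma AreIIDUnitPoisson.integrable_abs_rpow_map_scaled {Ω : Type*} [MeasurableSpace Ω]
    {P : Measure Ω} [IsProbabilityMeasure P] {n : ℕ} {N : Fin n → ℝ≥0 → Ω → ℕ}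
    (hN : AreIIDUnitPoisson N P) (k : ℕ) (b a : ℝ) {r : ℝ} (hr : 0 < r) :
    Integrable (fun x : ℝ => |x| ^ r)
      (P.map fun ω => (poissonTime (k + 1) N ω - b) / a) :=
  (integrable_map_measure (Measurable.aestronglyMeasurable (by fun_prop)) (hN.aemeasurable_scaled k b a)).2
    (hN.integrable_scaled k b a hr)

/-- All absolute moments of the scaled completion time converge to those of the Gumbel law. -/
theorem tendsto_integral_abs_scaled_rpow
    (hb : ∀ᶠ n : ℕ+ in atTop, 0 ≤ b n ∧ (n : ℝ) * gammaTail (k n + 1) (b n) = 1)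
    (hN : ∀ n, AreIIDUnitPoisson (N n) (P n)) {r : ℝ} (hr : 0 < r) :
    Tendsto (fun n => ∫ ω, |(poissonTime (k n + 1) (N n) ω - b n) /
      millsRatio (k n + 1) (b n)| ^ r ∂(P n)) atTop (𝓝 (∫ x : ℝ, |x| ^ r ∂gumbelMeasure)) := by
  have hprob : ∀ n, IsProbabilityMeasure ((P n).map fun ω =>
      (poissonTime (k n + 1) (N n) ω - b n) / millsRatio (k n + 1) (b n)) := fun n =>
    Measure.isProbabilityMeasure_map ((hN n).aemeasurable_scaled _ _ _)
  have htails := eventually_map_scaled_tails hb hN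
  have h := tendsto_integral_abs_rpow hr (tendsto_map_scaled_Iic hb hN)
    (htails.mono fun n hn t ht => (hn t ht).1) (htails.mono fun n hn t ht => (hn t ht).2)
    (fun n => (hN n).integrable_abs_rpow_map_scaled _ _ _ hr) (integrable_abs_rpow_gumbel hr.le)
  refine h.congr fun n => ?_
  rw [integral_map ((hN n).aemeasurable_scaled _ _ _)
    (Measurable.aestronglyMeasurable (by fun_prop))]

theorem tendsto_integral_scaled
    (hb : ∀ᶠ n : ℕ+ in atTop, 0 ≤ b n ∧ (n : ℝ) * gammaTail (k n + 1) (b n) = 1)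
    (hN : ∀ n, AreIIDUnitPoisson (N n) (P n)) :
    Tendsto (fun n => ∫ ω, (poissonTime (k n + 1) (N n) ω - b n) /
      millsRatio (k n + 1) (b n) ∂(P n)) atTop (𝓝 Real.eulerMascheroniConstant) := by
  have hprob : ∀ n, IsProbabilityMeasure ((P n).map fun ω =>
      (poissonTime (k n + 1) (N n) ω - b n) / millsRatio (k n + 1) (b n)) := fun n =>
    Measure.isProbabilityMeasure_map ((hN n).aemeasurable_scaled _ _ _)
  have htails := eventually_map_scaled_tails hb hN
  have h := tendsto_integral_id (tendsto_map_scaled_Iic hb hN)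
    (htails.mono fun n hn t ht => (hn t ht).1) (htails.mono fun n hn t ht => (hn t ht).2)
    (fun n => (hN n).integrable_abs_rpow_map_scaled _ _ _ one_pos)
    (integrable_abs_rpow_gumbel zero_le_one)
  rw [integral_id_gumbel] at h
  refine h.congr fun n => ?_
  rw [integral_map ((hN n).aemeasurable_scaled _ _ _)
    (Measurable.aestronglyMeasurable (by fun_prop))]

theorem tendsto_variance_scaled
    (hb : ∀ᶠ n : ℕ+ in atTop, 0 ≤ b n ∧ (n : ℝ) * gammaTail (k n + 1) (b n) = 1)
    (hN : ∀ n, AreIIDUnitPoisson (N n) (P n)) :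
    Tendsto (fun n => variance (fun ω => (poissonTime (k n + 1) (N n) ω - b n) /
      millsRatio (k n + 1) (b n)) (P n)) atTop (𝓝 (Real.pi ^ 2 / 6)) := by
  have h1 := tendsto_integral_scaled hb hN
  have h2 := tendsto_integral_abs_scaled_rpow hb hN two_pos
  simp only [Real.rpow_two, sq_abs, integral_sq_gumbel] at h2
  have h := h2.sub (h1.pow 2)
  rw [add_sub_cancel_right] at h
  refine h.congr fun n => ?_
  have hL : MemLp (fun ω => (poissonTime (k n + 1) (N n) ω - b n) /
      millsRatio (k n + 1) (b n)) 2 (P n) := by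
    simpa using (hN n).memLp_scaled (k n) (b n) (millsRatio (k n + 1) (b n)) two_pos
  rw [variance_eq_sub hL]
  rfl

lemma AreIIDUnitPoisson.integral_poissonTime {Ω : Type*} [MeasurableSpace Ω]
    {P : Measure Ω} [IsProbabilityMeasure P] {n : ℕ} {N : Fin n → ℝ≥0 → Ω → ℕ}
    (hN : AreIIDUnitPoisson N P) (k : ℕ) (b : ℝ) {a : ℝ} (ha : a ≠ 0) :
    ∫ ω, poissonTime (k + 1) N ω ∂P =
      b + a * ∫ ω, (poissonTime (k + 1) N ω - b) / a ∂P := by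
  have hi := (hN.memLp_two_poissonTime k).integrable one_le_two
  rw [integral_div, integral_sub hi (integrable_const b), integral_const, probReal_univ, one_smul]
  field_simp
  ring

lemma AreIIDUnitPoisson.variance_poissonTime {Ω : Type*} [MeasurableSpace Ω]
    {P : Measure Ω} [IsProbabilityMeasure P] {n : ℕ} {N : Fin n → ℝ≥0 → Ω → ℕ}
    (hN : AreIIDUnitPoisson N P) (k : ℕ) (b : ℝ) {a : ℝ} (ha : a ≠ 0) :
    variance (poissonTime (k + 1) N) P =
      a ^ 2 * variance (fun ω => (poissonTime (k + 1) N ω - b) / a) P := by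
  simp only [div_eq_inv_mul]
  rw [variance_const_mul, variance_sub_const (hN.memLp_two_poissonTime k).aestronglyMeasurable]
  field_simp

lemma isLittleO_of_tendsto_of_eventuallyEq {u f g : ℕ+ → ℝ} (hu : Tendsto u atTop (𝓝 0))
    (h : ∀ᶠ n in atTop, f n = u n * g n) : f =o[atTop] g := by
  have := ((Asymptotics.isLittleO_one_iff ℝ).2 hu).mul_isBigO (Asymptotics.isBigO_refl g atTop)
  simp only [one_mul] at this
  exact this.congr' (h.mono fun n hn => hn.symm) EventuallyEq.rfl

end Limit

theorem mainTheorem3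
    -- the multiplicities, an arbitrary sequence of positive integers
    (m : ℕ+ → ℕ) (hm : ∀ n, 1 ≤ m n)
    -- centering and scaling
    (b a : ℕ+ → ℝ)
    (hb : ∀ᶠ n : ℕ+ in atTop, 0 ≤ b n ∧ (n : ℝ) * gammaTail (m n) (b n) = 1)
    (ha : ∀ n, a n = gammaTail (m n) (b n) / gammaDens (m n) (b n))
    -- for each `n`, independent rate-one Poisson processes
    {Ω : ℕ+ → Type*} [∀ n, MeasurableSpace (Ω n)]
    (P : ∀ n, Measure (Ω n)) [∀ n, IsProbabilityMeasure (P n)]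
    (N : ∀ n : ℕ+, Fin (n : ℕ) → ℝ≥0 → Ω n → ℕ)
    (hN : ∀ n, AreIIDUnitPoisson (N n) (P n))
    -- for each `n`, independent uniform draws from `n` coupon types
    {Ω' : ℕ+ → Type*} [∀ n, MeasurableSpace (Ω' n)]
    (P' : ∀ n, Measure (Ω' n)) [∀ n, IsProbabilityMeasure (P' n)]
    (U : ∀ n : ℕ+, ℕ → Ω' n → Fin (n : ℕ))
    (hU : ∀ n, IsUniformDraws (U n) (P' n)) :
    -- convergence of all absolute moments of `(τ_n - b_n) / a_n`, which are finite
    (∀ r : ℝ, 0 < r →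
      (∀ n, Integrable (fun ω => |(poissonTime (m n) (N n) ω - b n) / a n| ^ r) (P n)) ∧
      Integrable (fun x : ℝ => |x| ^ r) gumbelMeasure ∧
      Tendsto (fun n => ∫ ω, |(poissonTime (m n) (N n) ω - b n) / a n| ^ r ∂(P n)) atTop
        (𝓝 (∫ x : ℝ, |x| ^ r ∂gumbelMeasure))) ∧
    -- mean and variance of the number of draws
    (∀ n, MemLp (fun ω => (couponTime (m n) (U n) ω : ℝ)) 2 (P' n)) ∧
    (fun n : ℕ+ => (∫ ω, (couponTime (m n) (U n) ω : ℝ) ∂(P' n))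
        - ((n : ℝ) * b n + Real.eulerMascheroniConstant * (n : ℝ) * a n))
      =o[atTop] (fun n : ℕ+ => (n : ℝ) * a n) ∧
    (fun n : ℕ+ => variance (fun ω => (couponTime (m n) (U n) ω : ℝ)) (P' n)
        - Real.pi ^ 2 / 6 * (n : ℝ) ^ 2 * a n ^ 2)
      =o[atTop] (fun n : ℕ+ => (n : ℝ) ^ 2 * a n ^ 2) := by
  obtain ⟨k, rfl⟩ : ∃ k : ℕ+ → ℕ, m = fun n => k n + 1 :=
    ⟨fun n => m n - 1, funext fun n => (Nat.sub_add_cancel (hm n)).symm⟩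
  obtain rfl : a = fun n => millsRatio (k n + 1) (b n) := funext ha
  have hpos : ∀ᶠ n : ℕ+ in atTop, 0 < b n :=
    (eventually_lt_of_tail hb).mono fun n hn => (k n).cast_nonneg.trans_lt hn
  refine ⟨fun r hr => ⟨fun n => (hN n).integrable_scaled (k n) (b n) _ hr,
    integrable_abs_rpow_gumbel hr.le, tendsto_integral_abs_scaled_rpow hb hN hr⟩,
    fun n => (hU n).memLp_couponTime (hN n) n.pos (k n), ?_, ?_⟩
  · have h := (tendsto_integral_scaled hb hN).sub_const Real.eulerMascheroniConstant
    rw [sub_self] at h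
    refine isLittleO_of_tendsto_of_eventuallyEq h ?_
    filter_upwards [hpos] with n hn
    rw [(hU n).integral_couponTime (hN n) n.pos (k n),
      (hN n).integral_poissonTime (k n) (b n) (millsRatio_pos (k n) hn).ne']
    ring
  -- As `a n ≥ 1`, the fluctuation part of `n E τ`, of order `n a n`, is negligible against `n² (a
  -- n)²`.
  · have hinv : Tendsto (fun n : ℕ+ => ((n : ℝ) * millsRatio (k n + 1) (b n))⁻¹) atTop (𝓝 0) := by
      refine (tendsto_atTop_mono' _ ?_ tendsto_pnat_coe_atTop).inv_tendsto_atTop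
      filter_upwards [hpos] with n hn
      exact le_mul_of_one_le_right (Nat.cast_nonneg _) (one_le_millsRatio (k n) hn)
    -- The three null terms are the variance error, `b/(n a²)`, and the scaled mean times `1/(n a)`;
    -- the last two come from dividing `n E τ` by `n² a²`.
    have h := (((tendsto_variance_scaled hb hN).sub_const (Real.pi ^ 2 / 6)).sub
      (tendsto_div_mul_millsRatio_sq hb)).sub ((tendsto_integral_scaled hb hN).mul hinv)
    rw [sub_self, mul_zero, sub_zero, sub_zero] at h
    refine isLittleO_of_tendsto_of_eventuallyEq h ?_
    filter_upwards [hpos] with n hn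
    have hM := (millsRatio_pos (k n) hn).ne'
    have hn0 : (n : ℝ) ≠ 0 := by exact_mod_cast n.pos.ne'
    rw [(hU n).variance_couponTime (hN n) n.pos (k n),
      (hN n).integral_poissonTime (k n) (b n) hM, (hN n).variance_poissonTime (k n) (b n) hM]
    field_simp
    ring
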